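/- Let $L/K$ be a separable extension of fields of finite degree; no further assumption is made on $K$, which may be finite or infinite and of any characteristic. Call $x\in L$ a generator of $L/K$ if $L=K(x)$; the equation of $x$ is then its minimal polynomial over $K$ set equal to $0$, and it has degree $[L:K]$. (a) Suppose $[L:K]=5$. If $K\not\cong\mathbb F_2$, then there are a generator $x$ of $L/K$ and elements $b,c\in K$ such that the minimal polynomial of $x$ over $K$ is $$X^5+bX^3+cX+c.$$ If $K\cong\mathbb F_2$, then there is a generator $x$ of $L/K$ with minimal polynomial $X^5+X^3+1$, and no generator of $L/K$ has a minimal polynomial of the form $X^5+bX^3+cX+c$ with $b,c\in K$. (b) Suppose $[L:K]=6$ and $\operatorname{char}K\neq 2$. Then there are a generator $x$ of $L/K$ and elements $b,c,d\in K$ such that the minimal polynomial of $x$ over $K$ is $$X^6+bX^4+cX^2+dX+d.$$ -/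

import Mathlib

open Polynomial
open scoped IntermediateField

/-! ### Generators, conjugates and scaling -/

section NormalForm

variable {K L : Type*} [Field K] [Field L] [Algebra K L] [FiniteDimensional K L]

/-! Scaling a generator equates the last two coefficients of its equation once the coefficient of X
is nonzero. So it suffices to find a generator whose conjugates have elementary symmetric functions
e₁ = e₃ = 0, with that coefficient nonzero.

Degree 6, K infinite: Joubert's cubic covariants of six points satisfy e₁ = e₃ = 0, but they are
permuted through the outer automorphism of S₆. Iterating them gives an S₆-equivariant map, which
sends conjugates of an element of L to conjugates of another
(`exists_conjugates_eq_of_equivariant`). Degree 6, K finite: take x = m + νs with m, ν in the cubic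
subfield and F s = -s, for F the Frobenius; the conditions become Tr m = 0 and s² Tr(mν²) + N(m) =
0, and the latter is linear under translation of ν.

Degree 5, K infinite: outside characteristic 5, if θ has equation f and canonizant j, then
j(θ)/f'(θ) has e₁ = e₃ = 0 (`canonizantResultant_add_neg`); in characteristic 5 a translation
suffices. In both infinite cases genericity comes from `exists_eval_embeddings_ne_zero`.

Degree 5, K of order q: 1 + T + ⋯ + T⁴ = (T² - τT + 1)(T² - τ'T + 1) with τ² + τ = 1 and τ' = -1 -
τ. If τ ∈ K, the kernel of one factor at T = F consists of elements with e₁ = e₃ = 0. Otherwise the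
same factor at T = F² yields at least (q² + 1)(q - 1) elements of L with e₁ = e₃ = 0, too many for
e₄ to vanish on all of them when q > 2. For q = 2 every candidate polynomial factors. -/

theorem minpoly_eq_of_adjoin_eq_top {x : L} (hx : K⟮x⟯ = ⊤) {P : K[X]} (hP : P.Monic)
    (hdeg : P.natDegree = Module.finrank K L) (h0 : aeval x P = 0) : minpoly K x = P := by
  have hdvd := minpoly.dvd K x h0
  have h := (Field.primitive_element_iff_minpoly_natDegree_eq K x).1 hx
  exact (eq_of_monic_of_dvd_of_natDegree_le (minpoly.monic (Algebra.IsIntegral.isIntegral x)) hP hdvd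
    (by omega)).symm

theorem aeval_ne_zero_of_natDegree_lt {x : L} (hx : K⟮x⟯ = ⊤) {P : K[X]} (hP : P ≠ 0)
    (hdeg : P.natDegree < Module.finrank K L) : aeval x P ≠ 0 := by
  intro h0
  have h := (Field.primitive_element_iff_minpoly_natDegree_eq K x).1 hx
  have := natDegree_le_of_dvd (minpoly.dvd K x h0) hP
  omega

theorem adjoin_smul_eq_top {x : L} (hx : K⟮x⟯ = ⊤) {t : K} (ht : t ≠ 0) :
    K⟮algebraMap K L t * x⟯ = ⊤ := by
  rw [eq_top_iff, ← hx, IntermediateField.adjoin_simple_le_iff]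
  have h1 : algebraMap K L t * x ∈ K⟮algebraMap K L t * x⟯ := IntermediateField.mem_adjoin_simple_self _ _
  have h2 : algebraMap K L t⁻¹ ∈ K⟮algebraMap K L t * x⟯ := IntermediateField.algebraMap_mem _ _
  have h3 := mul_mem h2 h1
  rwa [← mul_assoc, ← map_mul, inv_mul_cancel₀ ht, map_one, one_mul] at h3

theorem adjoin_eq_top_of_finrank_prime (hp : (Module.finrank K L).Prime) {x : L}
    (hx : x ∉ (algebraMap K L).range) : K⟮x⟯ = ⊤ := by
  have h1 : Module.finrank K K⟮x⟯ ∣ Module.finrank K L :=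
    ⟨_, (Module.finrank_mul_finrank K K⟮x⟯ L).symm⟩
  rcases (Nat.dvd_prime hp).1 h1 with h | h
  · exfalso
    rw [IntermediateField.finrank_eq_one_iff, IntermediateField.adjoin_simple_eq_bot_iff] at h
    obtain ⟨a, ha⟩ := IntermediateField.mem_bot.1 h
    exact hx ⟨a, ha⟩
  · exact IntermediateField.eq_of_le_of_finrank_eq le_top (by rw [h, IntermediateField.finrank_top'])

/-- Replacing x by tx multiplies d by t⁴ and e by t⁵, so t = d/e equates them. If e were 0, dividing
by x would leave a quartic equation for a generator. -/
theorem exists_quintic_normal_form (hn : Module.finrank K L = 5) {x : L}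
    (hx : K⟮x⟯ = ⊤) {b d e : K} (hd : d ≠ 0)
    (h : x ^ 5 + algebraMap K L b * x ^ 3 + algebraMap K L d * x + algebraMap K L e = 0) :
    ∃ (x : L) (b c : K), K⟮x⟯ = ⊤ ∧ minpoly K x = X ^ 5 + C b * X ^ 3 + C c * X + C c := by
  have he : e ≠ 0 := by
    rintro rfl
    have hx0 : x ≠ 0 := by
      rintro rfl
      refine aeval_ne_zero_of_natDegree_lt hx (P := X) X_ne_zero ?_ (by simp)
      rw [natDegree_X]; omega
    have hm : (X ^ 4 + C b * X ^ 2 + C d : K[X]).natDegree = 4 := by compute_degree!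
    refine aeval_ne_zero_of_natDegree_lt hx (P := X ^ 4 + C b * X ^ 2 + C d) ?_ ?_ ?_
    · intro h0; simp [h0] at hm
    · omega
    · apply mul_left_cancel₀ hx0
      simp only [map_zero, add_zero] at h
      simp only [map_add, map_mul, map_pow, aeval_X, aeval_C]
      linear_combination h
  have ht : d / e ≠ 0 := div_ne_zero hd he
  refine ⟨algebraMap K L (d / e) * x, b * (d / e) ^ 2, d * (d / e) ^ 4, adjoin_smul_eq_top hx ht,
    minpoly_eq_of_adjoin_eq_top (adjoin_smul_eq_top hx ht) ?_ ?_ ?_⟩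
  · monicity!
  · rw [hn]; compute_degree!
  · have h5 : d * (d / e) ^ 4 = e * (d / e) ^ 5 := by field_simp
    have : aeval (algebraMap K L (d / e) * x) (X ^ 5 + C (b * (d / e) ^ 2) * X ^ 3 +
        C (d * (d / e) ^ 4) * X + C (e * (d / e) ^ 5) : K[X]) = 0 := by
      simp only [map_add, map_mul, map_pow, aeval_X, aeval_C]
      linear_combination (algebraMap K L (d / e)) ^ 5 * h
    rwa [← h5] at this

theorem exists_sextic_normal_form (hn : Module.finrank K L = 6) {x : L}
    (hx : K⟮x⟯ = ⊤) {b c d e : K} (hd : d ≠ 0)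
    (h : x ^ 6 + algebraMap K L b * x ^ 4 + algebraMap K L c * x ^ 2 + algebraMap K L d * x +
      algebraMap K L e = 0) :
    ∃ (x : L) (b c d : K), K⟮x⟯ = ⊤ ∧
      minpoly K x = X ^ 6 + C b * X ^ 4 + C c * X ^ 2 + C d * X + C d := by
  have he : e ≠ 0 := by
    rintro rfl
    have hx0 : x ≠ 0 := by
      rintro rfl
      refine aeval_ne_zero_of_natDegree_lt hx (P := X) X_ne_zero ?_ (by simp)
      rw [natDegree_X]; omega
    have hm : (X ^ 5 + C b * X ^ 3 + C c * X + C d : K[X]).natDegree = 5 := by compute_degree!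
    refine aeval_ne_zero_of_natDegree_lt hx (P := X ^ 5 + C b * X ^ 3 + C c * X + C d) ?_ ?_ ?_
    · intro h0; simp [h0] at hm
    · omega
    · apply mul_left_cancel₀ hx0
      simp only [map_zero, add_zero] at h
      simp only [map_add, map_mul, map_pow, aeval_X, aeval_C]
      linear_combination h
  have ht : d / e ≠ 0 := div_ne_zero hd he
  refine ⟨algebraMap K L (d / e) * x, b * (d / e) ^ 2, c * (d / e) ^ 4, d * (d / e) ^ 5,
    adjoin_smul_eq_top hx ht, minpoly_eq_of_adjoin_eq_top (adjoin_smul_eq_top hx ht) ?_ ?_ ?_⟩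
  · monicity!
  · rw [hn]; compute_degree!
  · have h5 : d * (d / e) ^ 5 = e * (d / e) ^ 6 := by field_simp
    have : aeval (algebraMap K L (d / e) * x) (X ^ 6 + C (b * (d / e) ^ 2) * X ^ 4 +
        C (c * (d / e) ^ 4) * X ^ 2 + C (d * (d / e) ^ 5) * X + C (e * (d / e) ^ 6) : K[X]) = 0 := by
      simp only [map_add, map_mul, map_pow, aeval_X, aeval_C]
      linear_combination (algebraMap K L (d / e)) ^ 6 * h
    rwa [← h5] at this

/-- The n distinct conjugates are roots of the minimal polynomial, whose degree is at most n. -/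
theorem minpoly_map_eq_prod {E : Type*} [Field E] [Algebra K E] {n : ℕ}
    (hn : Module.finrank K L = n) (σ : Fin n → L →ₐ[K] E) {x : L}
    (hσ : Function.Injective fun i => σ i x) :
    K⟮x⟯ = ⊤ ∧ (minpoly K x).map (algebraMap K E) = ∏ i, (X - C (σ i x)) := by
  have hint : IsIntegral K x := Algebra.IsIntegral.isIntegral x
  have hmon : ((minpoly K x).map (algebraMap K E)).Monic := (minpoly.monic hint).map _
  have hdvd : ∏ i, (X - C (σ i x)) ∣ (minpoly K x).map (algebraMap K E) := by
    refine Finset.prod_dvd_of_coprime ?_ ?_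
    · intro i _ j _ hij
      exact isCoprime_X_sub_C_of_isUnit_sub (sub_ne_zero.2 (hσ.ne hij)).isUnit
    · intro i _
      rw [dvd_iff_isRoot, IsRoot.def, eval_map_algebraMap, aeval_algHom_apply, minpoly.aeval,
        map_zero]
  have hdp : (∏ i, (X - C (σ i x))).natDegree = n := by simp
  have hle := natDegree_le_of_dvd hdvd hmon.ne_zero
  rw [hdp, natDegree_map] at hle
  have hle' : (minpoly K x).natDegree ≤ n := hn ▸ minpoly.natDegree_le x
  refine ⟨(Field.primitive_element_iff_minpoly_natDegree_eq K x).2 (by omega), ?_⟩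
  exact (eq_of_monic_of_dvd_of_natDegree_le (monic_prod_of_monic _ _ fun i _ => monic_X_sub_C _) hmon
    hdvd (by rw [hdp, natDegree_map]; omega))

/-- The elements on which two embeddings agree form an intermediate field. -/
theorem injective_apply_of_adjoin_eq_top {E ι : Type*} [Field E] [Algebra K E]
    {σ : ι → L →ₐ[K] E} (hσ : Function.Injective σ) {x : L} (hx : K⟮x⟯ = ⊤) :
    Function.Injective fun i => σ i x := by
  intro i j hij
  apply hσ
  ext y
  have hle : K⟮x⟯ ≤ IntermediateField.mk (AlgHom.equalizer (σ i) (σ j))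
      (fun y hy => by
        have hy' : σ i y = σ j y := hy
        change σ i y⁻¹ = σ j y⁻¹
        rw [map_inv₀, map_inv₀, hy']) := by
    rw [IntermediateField.adjoin_simple_le_iff]; exact hij
  rw [hx] at hle
  exact hle (IntermediateField.mem_top (x := y))

end NormalForm

/-! ### Elementary symmetric functions of five and six elements -/

section ElementarySymmetric

variable {R : Type*} [CommRing R]

/-- The elementary symmetric functions of degree `1, …, 5` of five elements. -/
def quint1 (v : Fin 5 → R) : R := v 0 + v 1 + v 2 + v 3 + v 4
def quint2 (v : Fin 5 → R) : R :=
  v 0 * v 1 + v 0 * v 2 + v 0 * v 3 + v 0 * v 4 + v 1 * v 2 + v 1 * v 3 + v 1 * v 4 +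
    v 2 * v 3 + v 2 * v 4 + v 3 * v 4
def quint3 (v : Fin 5 → R) : R :=
  v 0 * v 1 * v 2 + v 0 * v 1 * v 3 + v 0 * v 1 * v 4 + v 0 * v 2 * v 3 + v 0 * v 2 * v 4 +
    v 0 * v 3 * v 4 + v 1 * v 2 * v 3 + v 1 * v 2 * v 4 + v 1 * v 3 * v 4 + v 2 * v 3 * v 4
def quint4 (v : Fin 5 → R) : R :=
  v 0 * v 1 * v 2 * v 3 + v 0 * v 1 * v 2 * v 4 + v 0 * v 1 * v 3 * v 4 + v 0 * v 2 * v 3 * v 4 +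
    v 1 * v 2 * v 3 * v 4
def quint5 (v : Fin 5 → R) : R := v 0 * v 1 * v 2 * v 3 * v 4

theorem prod_X_sub_C_fin_five (v : Fin 5 → R) :
    ∏ i, (X - C (v i)) = X ^ 5 - C (quint1 v) * X ^ 4 + C (quint2 v) * X ^ 3 -
      C (quint3 v) * X ^ 2 + C (quint4 v) * X - C (quint5 v) := by
  simp only [Fin.prod_univ_five, quint1, quint2, quint3, quint4, quint5, map_add, map_mul]
  ring

/-- The elementary symmetric functions of degree one and three of six elements. -/
def sext1 (v : Fin 6 → R) : R := v 0 + v 1 + v 2 + v 3 + v 4 + v 5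
def sext3 (v : Fin 6 → R) : R :=
  quint3 (fun i => v i.castSucc) + quint2 (fun i => v i.castSucc) * v 5

theorem prod_X_sub_C_fin_six (v : Fin 6 → R) :
    ∃ b c d e : R, ∏ i, (X - C (v i)) = X ^ 6 - C (sext1 v) * X ^ 5 + C b * X ^ 4 -
      C (sext3 v) * X ^ 3 + C c * X ^ 2 + C d * X + C e := by
  set w : Fin 5 → R := fun i => v i.castSucc with hw
  refine ⟨quint2 w + quint1 w * v 5, quint4 w + quint3 w * v 5, -(quint5 w + quint4 w * v 5),
    quint5 w * v 5, ?_⟩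
  have h1 : sext1 v = quint1 w + v 5 := rfl
  have h3 : sext3 v = quint3 w + quint2 w * v 5 := rfl
  rw [Fin.prod_univ_castSucc, prod_X_sub_C_fin_five w, h1, h3]
  simp only [map_add, map_mul, map_neg, show Fin.last 5 = (5 : Fin 6) from rfl]
  ring

end ElementarySymmetric

/-! ### Normal forms from conditions on conjugates -/

section Conjugates

variable {K L E : Type*} [Field K] [Field L] [Algebra K L] [FiniteDimensional K L]
  [Field E] [Algebra K E]

theorem exists_quintic_normal_form_of_conjugates (hn : Module.finrank K L = 5)
    (σ : Fin 5 → L →ₐ[K] E) (hσ : Function.Injective σ) {x : L}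
    (hx : x ∉ (algebraMap K L).range) (h1 : quint1 (fun i => σ i x) = 0)
    (h3 : quint3 (fun i => σ i x) = 0) (h4 : quint4 (fun i => σ i x) ≠ 0) :
    ∃ (x : L) (b c : K), K⟮x⟯ = ⊤ ∧ minpoly K x = X ^ 5 + C b * X ^ 3 + C c * X + C c := by
  have hgen := adjoin_eq_top_of_finrank_prime (by rw [hn]; norm_num) hx
  obtain ⟨-, hmap⟩ := minpoly_map_eq_prod hn σ (injective_apply_of_adjoin_eq_top hσ hgen)
  rw [prod_X_sub_C_fin_five, h1, h3] at hmap
  have hdeg : (minpoly K x).natDegree = 5 :=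
    hn ▸ (Field.primitive_element_iff_minpoly_natDegree_eq K x).1 hgen
  have hmon := minpoly.monic (Algebra.IsIntegral.isIntegral (R := K) x)
  have hc : ∀ k, algebraMap K E ((minpoly K x).coeff k) = coeff ((minpoly K x).map (algebraMap K E)) k :=
    fun k => (coeff_map _ _).symm
  have c5 : (minpoly K x).coeff 5 = 1 := by rw [← hdeg]; exact hmon
  have c4 : (minpoly K x).coeff 4 = 0 := by
    apply (algebraMap K E).injective
    rw [hc, hmap]; simp [coeff_X, coeff_C]
  have c2 : (minpoly K x).coeff 2 = 0 := by
    apply (algebraMap K E).injective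
    rw [hc, hmap]; simp [coeff_X, coeff_C]
  have c1 : (minpoly K x).coeff 1 ≠ 0 := by
    intro h
    apply h4
    have := hc 1
    rw [h, hmap] at this
    simpa [coeff_X, coeff_C, coeff_X_pow] using this.symm
  refine exists_quintic_normal_form hn hgen (b := (minpoly K x).coeff 3) (e := (minpoly K x).coeff 0) c1 ?_
  have := minpoly.aeval K x
  rw [aeval_eq_sum_range, hdeg] at this
  simp only [Finset.sum_range_succ, Finset.sum_range_zero, c5, c4, c2, Algebra.smul_def, map_one,
    map_zero] at this
  linear_combination this

theorem exists_sextic_normal_form_of_conjugates (hn : Module.finrank K L = 6)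
    (h2 : (2 : E) ≠ 0) (σ : Fin 6 → L →ₐ[K] E) {x : L}
    (hσ : Function.Injective fun i => σ i x) (h1 : sext1 (fun i => σ i x) = 0)
    (h3 : sext3 (fun i => σ i x) = 0) (hpair : ∀ i j, i ≠ j → σ i x + σ j x ≠ 0) :
    ∃ (x : L) (b c d : K), K⟮x⟯ = ⊤ ∧
      minpoly K x = X ^ 6 + C b * X ^ 4 + C c * X ^ 2 + C d * X + C d := by
  obtain ⟨hgen, hmap⟩ := minpoly_map_eq_prod hn σ hσ
  obtain ⟨b, c, d, e, hP⟩ := prod_X_sub_C_fin_six (fun i => σ i x)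
  -- With d = 0 the polynomial is even, so its roots are closed under negation. Distinct roots never
  -- sum to zero, so each root is its own negative, hence zero, against injectivity.
  have hd : d ≠ 0 := by
    rintro rfl
    rw [h1, h3] at hP
    have hz : ∀ i, σ i x = 0 := by
      intro i
      have hi : eval (σ i x) (∏ i, (X - C (σ i x))) = 0 := by
        rw [eval_prod]; exact Finset.prod_eq_zero (Finset.mem_univ i) (by simp)
      have hi' : eval (-σ i x) (∏ i, (X - C (σ i x))) = 0 := by
        rw [hP] at hi ⊢
        simp only [eval_add, eval_sub, eval_mul, eval_pow, eval_X, eval_C] at hi ⊢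
        linear_combination hi
      rw [eval_prod, Finset.prod_eq_zero_iff] at hi'
      obtain ⟨j, -, hj⟩ := hi'
      simp only [eval_sub, eval_X, eval_C] at hj
      by_cases hij : i = j
      · subst hij
        have : 2 * σ i x = 0 := by linear_combination -hj
        exact (mul_eq_zero.1 this).resolve_left h2
      · exact absurd (by linear_combination -hj) (hpair i j hij)
    exact absurd (hσ (a₁ := 0) (a₂ := 1) (by simp only [hz])) (by decide)
  rw [hP, h1, h3] at hmap
  have hdeg : (minpoly K x).natDegree = 6 :=
    hn ▸ (Field.primitive_element_iff_minpoly_natDegree_eq K x).1 hgen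
  have hmon := minpoly.monic (Algebra.IsIntegral.isIntegral (R := K) x)
  have hc : ∀ k, algebraMap K E ((minpoly K x).coeff k) = coeff ((minpoly K x).map (algebraMap K E)) k :=
    fun k => (coeff_map _ _).symm
  have c6 : (minpoly K x).coeff 6 = 1 := by rw [← hdeg]; exact hmon
  have c5 : (minpoly K x).coeff 5 = 0 := by
    apply (algebraMap K E).injective
    rw [hc, hmap]; simp [coeff_X, coeff_C]
  have c3 : (minpoly K x).coeff 3 = 0 := by
    apply (algebraMap K E).injective
    rw [hc, hmap]; simp [coeff_X, coeff_C]
  have c1 : (minpoly K x).coeff 1 ≠ 0 := by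
    intro h
    apply hd
    have := hc 1
    rw [h, hmap] at this
    simpa [coeff_X, coeff_C, coeff_X_pow] using this.symm
  refine exists_sextic_normal_form hn hgen (b := (minpoly K x).coeff 4) (c := (minpoly K x).coeff 2)
    (e := (minpoly K x).coeff 0) c1 ?_
  have := minpoly.aeval K x
  rw [aeval_eq_sum_range, hdeg] at this
  simp only [Finset.sum_range_succ, Finset.sum_range_zero, c6, c5, c3, Algebra.smul_def, map_one,
    map_zero] at this
  linear_combination this

end Conjugates

/-! ### Density of vectors of conjugates -/

section Density

variable {K L E : Type*} [Field K] [Field L] [Algebra K L] [FiniteDimensional K L]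
  [Field E] [Algebra K E] {n : ℕ}

theorem eq_zero_of_sum_mul_embeddings {σ : Fin n → L →ₐ[K] E} (hσ : Function.Injective σ)
    {a : Fin n → E} (h : ∀ x, ∑ i, a i * σ i x = 0) : a = 0 := by
  have hli := (linearIndependent_toLinearMap K L E).comp σ hσ
  rw [Fintype.linearIndependent_iff] at hli
  funext i
  refine hli a ?_ i
  ext x
  simpa using h x

theorem exists_sum_mul_embeddings_ne_zero {σ : Fin n → L →ₐ[K] E} (hσ : Function.Injective σ)
    (a : Fin n → E) (i : Fin n) (ha : a i ≠ 0) : ∃ x, ∑ i, a i * σ i x ≠ 0 := by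
  by_contra! h
  exact ha (congrFun (eq_zero_of_sum_mul_embeddings hσ h) i)

/-- In a basis of L/K the vectors of conjugates are the image of Kⁿ under a matrix A, invertible by
independence of embeddings. If P vanished on them, P ∘ A would vanish on Kⁿ, hence identically since
K is infinite. -/
theorem exists_eval_embeddings_ne_zero [Infinite K] (hn : Module.finrank K L = n)
    {σ : Fin n → L →ₐ[K] E} (hσ : Function.Injective σ) {P : MvPolynomial (Fin n) E}
    (hP : P ≠ 0) : ∃ x : L, MvPolynomial.eval (fun i => σ i x) P ≠ 0 := by
  have hinf : Infinite E := Infinite.of_injective _ (algebraMap K E).injective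
  obtain ⟨v, hv⟩ : ∃ v, MvPolynomial.eval v P ≠ 0 := by
    by_contra! h
    exact hP (MvPolynomial.funext fun x => by rw [h x, map_zero])
  let b := Module.finBasisOfFinrankEq K L hn
  let A : Matrix (Fin n) (Fin n) E := Matrix.of fun i k => σ i (b k)
  have hA : IsUnit A := by
    rw [← Matrix.vecMul_injective_iff_isUnit, ← Matrix.coe_vecMulLinear, ← LinearMap.ker_eq_bot,
      LinearMap.ker_eq_bot']
    intro a ha
    refine eq_zero_of_sum_mul_embeddings hσ fun x => ?_
    have hk : ∀ k, ∑ i, a i * σ i (b k) = 0 := fun k => congrFun ha k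
    rw [← b.sum_repr x]
    simp only [map_sum, Finset.mul_sum, Algebra.smul_def, map_mul, AlgHom.commutes]
    rw [Finset.sum_comm]
    refine Finset.sum_eq_zero fun k _ => ?_
    rw [← mul_zero (algebraMap K E (b.repr x k)), ← hk k, Finset.mul_sum]
    exact Finset.sum_congr rfl fun i _ => by ring
  by_contra! h
  let ℓ : Fin n → MvPolynomial (Fin n) E := fun i => ∑ k, MvPolynomial.C (A i k) * MvPolynomial.X k
  have hQ : MvPolynomial.bind₁ ℓ P = 0 := by
    refine MvPolynomial.funext_set (fun _ => Set.range (algebraMap K E))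
      (fun _ => Set.infinite_range_of_injective (algebraMap K E).injective) fun c hc => ?_
    choose t ht using fun i => hc i (Set.mem_univ i)
    have := h (∑ k, t k • b k)
    rw [map_zero, MvPolynomial.eval, MvPolynomial.eval₂Hom_bind₁, ← this]
    congr 2
    funext i
    simp [ℓ, A, ← ht, Algebra.smul_def, mul_comm]
  apply hv
  have := congrArg (MvPolynomial.eval (A⁻¹.mulVec v)) hQ
  rw [map_zero, MvPolynomial.eval, MvPolynomial.eval₂Hom_bind₁] at this
  rw [← this]
  congr 2
  have h2 : A.mulVec (A⁻¹.mulVec v) = v := by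
    rw [Matrix.mulVec_mulVec, Matrix.mul_nonsing_inv _ ((Matrix.isUnit_iff_isUnit_det _).1 hA),
      Matrix.one_mulVec]
  funext i
  conv_lhs => rw [← h2]
  simp [ℓ, Matrix.mulVec, dotProduct]

/-- On the elements of trace zero, a polynomial function of the conjugates that has a nonzero value
at some vector with coordinate sum zero has a nonzero value. -/
theorem exists_trace_zero_eval_embeddings_ne_zero [Infinite K] [Algebra.IsSeparable K L]
    [IsAlgClosed E] (hn : Module.finrank K L = n) (σ : Fin n ≃ (L →ₐ[K] E))
    (P : MvPolynomial (Fin n) E) (v : Fin n → E) (hv0 : ∑ i, v i = 0)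
    (hv : MvPolynomial.eval v P ≠ 0) :
    ∃ x : L, ∑ i, σ i x = 0 ∧ MvPolynomial.eval (fun i => σ i x) P ≠ 0 := by
  have htr : ∀ x : L, ∑ i, σ i x = algebraMap K E (Algebra.trace K L x) := fun x => by
    rw [trace_eq_sum_embeddings]; exact σ.sum_comp fun τ => τ x
  -- As w has trace 1, x ↦ x - Tr(x)w projects onto trace zero; the corresponding substitution ℓ
  -- fixes v.
  obtain ⟨w, hw⟩ := Algebra.trace_surjective K L 1
  let ℓ : Fin n → MvPolynomial (Fin n) E := fun i =>
    MvPolynomial.X i - (∑ k, MvPolynomial.X k) * MvPolynomial.C (σ i w)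
  have hQ : ∀ c, MvPolynomial.eval c (MvPolynomial.bind₁ ℓ P) =
      MvPolynomial.eval (fun i => c i - (∑ k, c k) * σ i w) P := fun c => by
    rw [MvPolynomial.eval, MvPolynomial.eval₂Hom_bind₁]
    congr 2
    funext i
    simp [ℓ]
  obtain ⟨x, hx⟩ := exists_eval_embeddings_ne_zero (P := MvPolynomial.bind₁ ℓ P) hn σ.injective (by
    intro h0
    apply hv
    have := hQ v
    simpa [h0, hv0] using this.symm)
  refine ⟨x - Algebra.trace K L x • w, ?_, ?_⟩
  · rw [htr, map_sub, map_smul, hw]; simp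
  · rw [hQ] at hx
    convert hx using 3 with i
    rw [htr]
    simp [Algebra.smul_def]

end Density

/-! ### Galois descent for equivariant maps -/

section Descent

variable {K L S : Type*} [Field K] [Field L] [Algebra K L] [FiniteDimensional K L]
  [Algebra.IsSeparable K L] [Field S] [Algebra K S] [IsGalois K S] {n : ℕ}

theorem exists_algEquiv_comp_eq (φ ψ : L →ₐ[K] S) :
    ∃ τ : S ≃ₐ[K] S, ∀ x, τ (φ x) = ψ x := by
  obtain ⟨α, hα⟩ := Field.exists_primitive_element K L
  obtain ⟨τ, hτ⟩ := minpoly.exists_algEquiv_of_root (K := K) (L := S) (x := φ α) (y := ψ α)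
    (Algebra.IsAlgebraic.isAlgebraic _) (by
      rw [minpoly.algHom_eq _ ψ.injective, aeval_algHom_apply, minpoly.aeval, map_zero])
  refine ⟨τ, fun x => ?_⟩
  by_contra hne
  have h := injective_apply_of_adjoin_eq_top (E := S)
    (σ := fun b : Bool => if b then (τ : S →ₐ[K] S).comp φ else ψ) (fun a b hab => by
      have hne' : (τ : S →ₐ[K] S).comp φ ≠ ψ := fun h => hne (DFunLike.congr_fun h x)
      cases a <;> cases b <;> simp_all [Ne.symm]) hα
  exact absurd (h (a₁ := true) (a₂ := false) (by simpa using hτ)) (by decide)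

/-- An equivariant map applied to the vector of conjugates of an element of `L` gives the vector
of conjugates of an element of `L`. -/
theorem exists_conjugates_eq_of_equivariant (hn : 0 < n) (σ : Fin n ≃ (L →ₐ[K] S))
    (Y : (Fin n → S) → Fin n → S) (hY : ∀ (τ : S ≃ₐ[K] S) x i, Y (fun j => τ (x j)) i = τ (Y x i))
    (hperm : ∀ (g : Equiv.Perm (Fin n)) x i, Y (x ∘ g) i = Y x (g i)) (θ : L) :
    ∃ y : L, ∀ i, σ i y = Y (fun j => σ j θ) i := by
  have key : ∀ (τ : S ≃ₐ[K] S) i k, (∀ x, τ (σ i x) = σ k x) →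
      τ (Y (fun j => σ j θ) i) = Y (fun j => σ j θ) k := by
    intro τ i k hτ
    let g : Equiv.Perm (Fin n) :=
      (σ.trans (AlgEquiv.arrowCongr AlgEquiv.refl τ)).trans σ.symm
    have hg : ∀ j x, σ (g j) x = τ (σ j x) := fun j x => by
      simp [g, AlgEquiv.arrowCongr]
    have hgi : g i = k := by
      apply σ.injective; ext x; rw [hg, hτ]
    rw [← hY, ← hgi, ← hperm g]
    congr 1
    funext j
    exact (hg j θ).symm
  let i₀ : Fin n := ⟨0, hn⟩
  -- Automorphisms fixing σ i₀ (L) pointwise fix the index i₀, hence this coordinate, which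
  -- therefore lies in σ i₀ (L). The other coordinates follow by transport along automorphisms.
  have hfix : Y (fun j => σ j θ) i₀ ∈ (⊥ : IntermediateField (σ i₀).fieldRange S) := by
    rw [InfiniteGalois.mem_bot_iff_fixed]
    intro f
    refine key (f.restrictScalars K) i₀ i₀ fun x => ?_
    exact f.commutes ⟨σ i₀ x, x, rfl⟩
  obtain ⟨⟨_, y, rfl⟩, hy⟩ := IntermediateField.mem_bot.1 hfix
  refine ⟨y, fun i => ?_⟩
  obtain ⟨τ, hτ⟩ := exists_algEquiv_comp_eq (σ i₀) (σ i)
  rw [← key τ i₀ i hτ, ← hy]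
  exact (hτ y).symm

end Descent

/-! ### Joubert's covariants of six points -/

section Joubert

variable {R : Type*} [CommRing R]

/-- The signed products of differences attached to the fifteen synthemes of six points; rows and
columns are indexed by the six synthematic totals, two of which share exactly one syntheme. -/
def synthemeProd (v : Fin 6 → R) : Fin 6 → Fin 6 → R :=
  ![![0,
      (v 0 - v 1) * (v 2 - v 3) * (v 4 - v 5),
      (v 0 - v 5) * (v 1 - v 2) * (v 3 - v 4),
      (v 0 - v 4) * (v 1 - v 3) * (v 2 - v 5),
      (v 0 - v 3) * (v 1 - v 5) * (v 2 - v 4),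
      (v 0 - v 2) * (v 1 - v 4) * (v 3 - v 5)],
    ![(v 0 - v 1) * (v 2 - v 3) * (v 4 - v 5),
      0,
      (v 3 - v 0) * (v 1 - v 4) * (v 2 - v 5),
      (v 2 - v 0) * (v 1 - v 5) * (v 3 - v 4),
      (v 4 - v 0) * (v 1 - v 2) * (v 3 - v 5),
      (v 5 - v 0) * (v 1 - v 3) * (v 2 - v 4)],
    ![(v 0 - v 5) * (v 1 - v 2) * (v 3 - v 4),
      (v 3 - v 0) * (v 1 - v 4) * (v 2 - v 5),
      0,
      (v 1 - v 0) * (v 2 - v 4) * (v 3 - v 5),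
      (v 2 - v 0) * (v 1 - v 3) * (v 4 - v 5),
      (v 4 - v 0) * (v 1 - v 5) * (v 2 - v 3)],
    ![(v 0 - v 4) * (v 1 - v 3) * (v 2 - v 5),
      (v 2 - v 0) * (v 1 - v 5) * (v 3 - v 4),
      (v 1 - v 0) * (v 2 - v 4) * (v 3 - v 5),
      0,
      (v 0 - v 5) * (v 1 - v 4) * (v 2 - v 3),
      (v 0 - v 3) * (v 1 - v 2) * (v 4 - v 5)],
    ![(v 0 - v 3) * (v 1 - v 5) * (v 2 - v 4),
      (v 4 - v 0) * (v 1 - v 2) * (v 3 - v 5),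
      (v 2 - v 0) * (v 1 - v 3) * (v 4 - v 5),
      (v 0 - v 5) * (v 1 - v 4) * (v 2 - v 3),
      0,
      (v 0 - v 1) * (v 2 - v 5) * (v 3 - v 4)],
    ![(v 0 - v 2) * (v 1 - v 4) * (v 3 - v 5),
      (v 5 - v 0) * (v 1 - v 3) * (v 2 - v 4),
      (v 4 - v 0) * (v 1 - v 5) * (v 2 - v 3),
      (v 0 - v 3) * (v 1 - v 2) * (v 4 - v 5),
      (v 0 - v 1) * (v 2 - v 5) * (v 3 - v 4),
      0]]

/-- Joubert's cubic covariants of six points, one for every synthematic total. -/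
def joubert (v : Fin 6 → R) (i : Fin 6) : R :=
  synthemeProd v i 0 + synthemeProd v i 1 + synthemeProd v i 2 + synthemeProd v i 3 +
    synthemeProd v i 4 + synthemeProd v i 5

/-- A labelling by `Fin 6` of the totals of totals, which identifies them with the points. -/
def totalOfTotals : Fin 6 → Fin 6 := ![1, 0, 5, 4, 2, 3]

/-- The equivariant polynomial map of degree nine obtained by iterating Joubert's covariants. -/
def joubertIterate (v : Fin 6 → R) (i : Fin 6) : R := joubert (joubert v) (totalOfTotals i)

/-- The action of the adjacent transpositions on the six totals. -/
def totalPerm : Fin 5 → Fin 6 → Fin 6 :=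
  ![![1, 0, 3, 2, 5, 4], ![2, 4, 0, 5, 1, 3], ![1, 0, 5, 4, 3, 2], ![2, 3, 0, 1, 5, 4],
    ![1, 0, 4, 5, 2, 3]]

theorem map_joubert {S : Type*} [CommRing S] (f : R →+* S) (v : Fin 6 → R) (i : Fin 6) :
    f (joubert v i) = joubert (fun j => f (v j)) i := by
  fin_cases i <;> simp [joubert, synthemeProd]

theorem map_joubertIterate {S : Type*} [CommRing S] (f : R →+* S) (v : Fin 6 → R) (i : Fin 6) :
    f (joubertIterate v i) = joubertIterate (fun j => f (v j)) i := by
  simp only [joubertIterate, map_joubert]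

/-- This factorisation of the pair sums drives both `sext3_joubert` and the nonvanishing of the
coefficient of X in the sextic. -/
theorem joubert_add (v : Fin 6 → R) {i j : Fin 6} (h : i ≠ j) :
    joubert v i + joubert v j = 4 * synthemeProd v i j := by
  fin_cases i <;> fin_cases j <;> first | exact absurd rfl h | (simp [joubert, synthemeProd]; ring)

theorem synthemeProd_ne_zero [IsDomain R] {v : Fin 6 → R} (hv : Function.Injective v)
    {i j : Fin 6} (h : i ≠ j) : synthemeProd v i j ≠ 0 := by
  have hs : ∀ a b, a ≠ b → v a - v b ≠ 0 := fun a b hab => sub_ne_zero.2 (hv.ne hab)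
  fin_cases i <;> fin_cases j <;> first
    | exact absurd rfl h
    | exact mul_ne_zero (mul_ne_zero (hs _ _ (by decide)) (hs _ _ (by decide))) (hs _ _ (by decide))

theorem sext1_joubert (v : Fin 6 → R) : sext1 (joubert v) = 0 := by
  simp [sext1, joubert, synthemeProd]; ring

/-- When e₁ = 0, -e₃ is the sum of (a + b)(b + c)(a + c) over two complementary triples. Each factor
is 4 times a syntheme product, so a sextic identity between syntheme products suffices. -/
theorem sext3_joubert (v : Fin 6 → R) : sext3 (joubert v) = 0 := by
  have h1 := sext1_joubert v
  have hp : synthemeProd v 0 1 * synthemeProd v 1 2 * synthemeProd v 0 2 +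
      synthemeProd v 3 4 * synthemeProd v 4 5 * synthemeProd v 3 5 = 0 := by
    simp [synthemeProd]; ring
  have h64 : (joubert v 0 + joubert v 1) * (joubert v 1 + joubert v 2) *
      (joubert v 0 + joubert v 2) + (joubert v 3 + joubert v 4) * (joubert v 4 + joubert v 5) *
      (joubert v 3 + joubert v 5) = 0 := by
    rw [joubert_add v (show (0 : Fin 6) ≠ 1 by decide), joubert_add v (show (1 : Fin 6) ≠ 2 by decide),
      joubert_add v (show (0 : Fin 6) ≠ 2 by decide), joubert_add v (show (3 : Fin 6) ≠ 4 by decide),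
      joubert_add v (show (4 : Fin 6) ≠ 5 by decide), joubert_add v (show (3 : Fin 6) ≠ 5 by decide)]
    linear_combination 64 * hp
  generalize joubert v = w at h1 h64
  simp only [sext1, sext3, quint3, quint2, Fin.castSucc_zero, Fin.reduceCastSucc] at *
  linear_combination (w 0 * w 1 + w 0 * w 2 + w 1 * w 2 + w 3 * w 4 + w 3 * w 5 + w 4 * w 5) * h1 -
    h64

theorem joubert_neg (v : Fin 6 → R) (i : Fin 6) : joubert (-v) i = -joubert v i := by
  fin_cases i <;> simp [joubert, synthemeProd] <;> ring

/-- A transposition of points acts on totals as three disjoint transpositions, as the outer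
automorphism of S₆ does, up to a sign. The sign disappears on iteration because `joubert` is odd. -/
theorem joubert_comp_swap (k : Fin 5) (v : Fin 6 → R) (i : Fin 6) :
    joubert (v ∘ Equiv.swap k.castSucc k.succ) i = -joubert v (totalPerm k i) := by
  fin_cases k <;> fin_cases i <;>
    simp [joubert, synthemeProd, totalPerm, Equiv.swap_apply_def] <;> ring

theorem joubert_comp_totalPerm (k : Fin 5) (v : Fin 6 → R) (i : Fin 6) :
    joubert (v ∘ totalPerm k) (totalOfTotals i) =
      -joubert v (totalOfTotals (Equiv.swap k.castSucc k.succ i)) := by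
  fin_cases k <;> fin_cases i <;>
    simp [joubert, synthemeProd, totalPerm, totalOfTotals, Equiv.swap_apply_def] <;> ring

end Joubert

/-! ### The iterated covariants and sextics over infinite fields -/

section JoubertIterate

theorem joubertIterate_comp_perm {R : Type*} [CommRing R] (g : Equiv.Perm (Fin 6)) (v : Fin 6 → R)
    (i : Fin 6) : joubertIterate (v ∘ g) i = joubertIterate v (g i) := by
  have hg : g ∈ Submonoid.closure
      (Set.range fun k : Fin 5 => Equiv.swap k.castSucc k.succ) := by
    rw [Equiv.Perm.mclosure_swap_castSucc_succ]; trivial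
  induction hg using Submonoid.closure_induction generalizing v i with
  | one => simp
  | mul g h _ _ hg hh =>
    have : v ∘ ⇑(g * h) = (v ∘ g) ∘ h := rfl
    rw [this, hh, hg]; rfl
  | mem g hg =>
    obtain ⟨k, rfl⟩ := hg
    have h : joubert (v ∘ Equiv.swap k.castSucc k.succ) = -(joubert v ∘ totalPerm k) :=
      funext fun j => joubert_comp_swap k v j
    rw [joubertIterate, h, joubert_neg, joubert_comp_totalPerm, neg_neg, joubertIterate]

theorem sext1_joubertIterate {R : Type*} [CommRing R] (v : Fin 6 → R) :
    sext1 (joubertIterate v) = 0 := by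
  have h := sext1_joubert (joubert v)
  simp only [sext1, joubertIterate, totalOfTotals] at *
  simp
  linear_combination h

theorem sext3_joubertIterate {R : Type*} [CommRing R] (v : Fin 6 → R) :
    sext3 (joubertIterate v) = 0 := by
  have h := sext3_joubert (joubert v)
  simp only [sext3, quint2, quint3, joubertIterate, totalOfTotals, Fin.castSucc_zero,
    Fin.reduceCastSucc] at *
  simp
  linear_combination h

/-- A power of 2 stays nonzero in every characteristic other than 2, so integral test vectors
separate the covariants over all such fields at once. -/
theorem exists_joubert_sub_eq_two_pow {i j : Fin 6} (h : i ≠ j) :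
    ∃ (v : Fin 6 → ℤ) (k : ℕ), joubert v i - joubert v j = 2 ^ k ∨
      joubert v i - joubert v j = -2 ^ k := by
  have : ∀ i j : Fin 6, i ≠ j →
      ∃ v ∈ [![1, 1, 1, 0, 0, 0], ![1, 1, 0, 1, 0, 0], ![1, 1, 0, 0, 1, 0], ![1, 0, 1, 1, (0 : ℤ), 0]],
        joubert v i - joubert v j = 2 ^ 2 ∨ joubert v i - joubert v j = -2 ^ 2 := by decide
  obtain ⟨v, -, hv⟩ := this i j h
  exact ⟨v, 2, hv⟩

theorem exists_joubertIterate_sub_eq_two_pow {i j : Fin 6} (h : i ≠ j) :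
    ∃ (v : Fin 6 → ℤ) (k : ℕ), joubertIterate v i - joubertIterate v j = 2 ^ k ∨
      joubertIterate v i - joubertIterate v j = -2 ^ k := by
  have : ∀ i j : Fin 6, i ≠ j →
      ∃ v ∈ [![1, 1, 1, 0, 0, 0], ![1, 1, 0, 1, 0, 0], ![1, 1, 0, 0, 1, 0], ![1, 0, 1, 1, (0 : ℤ), 0]],
        joubertIterate v i - joubertIterate v j = 2 ^ 8 ∨
        joubertIterate v i - joubertIterate v j = -2 ^ 8 := by decide
  obtain ⟨v, -, hv⟩ := this i j h
  exact ⟨v, 8, hv⟩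

theorem intCast_ne_zero_of_eq_two_pow {E : Type*} [Field E] (h2 : (2 : E) ≠ 0) {a : ℤ} {k : ℕ}
    (h : a = 2 ^ k ∨ a = -2 ^ k) : (a : E) ≠ 0 := by
  rcases h with rfl | rfl <;> simp [h2]

theorem MvPolynomial.joubert_X_injective {E : Type*} [Field E] (h2 : (2 : E) ≠ 0) :
    Function.Injective (joubert (MvPolynomial.X : Fin 6 → MvPolynomial (Fin 6) E)) := by
  intro i j hij
  by_contra h
  obtain ⟨v, k, hv⟩ := exists_joubert_sub_eq_two_pow h
  apply intCast_ne_zero_of_eq_two_pow h2 hv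
  have h1 := congrArg (MvPolynomial.eval fun j => (v j : E)) hij
  rw [map_joubert, map_joubert] at h1
  simp only [MvPolynomial.eval_X] at h1
  have h3 := fun i => map_joubert (Int.castRingHom E) v i
  simp only [eq_intCast] at h3
  rw [Int.cast_sub, h3, h3, h1, sub_self]

theorem MvPolynomial.joubertIterate_X_injective {E : Type*} [Field E] (h2 : (2 : E) ≠ 0) :
    Function.Injective (joubertIterate (MvPolynomial.X : Fin 6 → MvPolynomial (Fin 6) E)) := by
  intro i j hij
  by_contra h
  obtain ⟨v, k, hv⟩ := exists_joubertIterate_sub_eq_two_pow h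
  apply intCast_ne_zero_of_eq_two_pow h2 hv
  have h1 := congrArg (MvPolynomial.eval fun j => (v j : E)) hij
  rw [map_joubertIterate, map_joubertIterate] at h1
  simp only [MvPolynomial.eval_X] at h1
  have h3 := fun i => map_joubertIterate (Int.castRingHom E) v i
  simp only [eq_intCast] at h3
  rw [Int.cast_sub, h3, h3, h1, sub_self]

/-- The product of the differences of distinct members of a family. -/
def prodDifferences {R : Type*} [CommRing R] {n : ℕ} (v : Fin n → R) : R :=
  ∏ i, ∏ j ∈ Finset.univ.erase i, (v i - v j)

theorem prodDifferences_ne_zero_iff {R : Type*} [CommRing R] [IsDomain R] {n : ℕ} {v : Fin n → R} :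
    prodDifferences v ≠ 0 ↔ Function.Injective v := by
  simp only [prodDifferences, ne_eq, Finset.prod_eq_zero_iff, not_exists, not_and, sub_eq_zero,
    Finset.mem_univ, true_and, Finset.mem_erase, and_true]
  exact ⟨fun h i j hij => by_contra fun hne => h i j (Ne.symm hne) hij,
    fun h i j hne hij => hne (h hij).symm⟩

theorem map_prodDifferences {R S : Type*} [CommRing R] [CommRing S] (f : R →+* S) {n : ℕ}
    (v : Fin n → R) : f (prodDifferences v) = prodDifferences fun i => f (v i) := by
  simp [prodDifferences]

theorem exists_sextic_normal_form_of_infinite {K L : Type*} [Field K] [Field L] [Algebra K L]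
    [Algebra.IsSeparable K L] [Infinite K] (hn : Module.finrank K L = 6) (h2 : ringChar K ≠ 2) :
    ∃ (x : L) (b c d : K), K⟮x⟯ = ⊤ ∧
      minpoly K x = X ^ 6 + C b * X ^ 4 + C c * X ^ 2 + C d * X + C d := by
  have : FiniteDimensional K L := Module.finite_of_finrank_pos (by omega)
  let S := SeparableClosure K
  have h2S : (2 : S) ≠ 0 := by
    have : (2 : K) ≠ 0 := Ring.two_ne_zero h2
    intro h
    apply this
    apply (algebraMap K S).injective
    rw [map_zero, ← h, map_ofNat]
  have hcard : Fintype.card (L →ₐ[K] S) = 6 := by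
    rw [AlgHom.card_of_splits _ _ _ fun x => IsSepClosed.splits_codomain _
      (Algebra.IsSeparable.isSeparable K x), hn]
  let σ : Fin 6 ≃ (L →ₐ[K] S) := (Fintype.equivFinOfCardEq hcard).symm
  -- The second factor makes the final conjugates distinct. The first makes the intermediate
  -- covariants distinct, so that the final pair sums, 4 times products of their differences, are
  -- nonzero.
  obtain ⟨θ, hθ⟩ := exists_eval_embeddings_ne_zero hn σ.injective
    (P := prodDifferences (joubert MvPolynomial.X) * prodDifferences (joubertIterate MvPolynomial.X))
    (mul_ne_zero (prodDifferences_ne_zero_iff.2 (MvPolynomial.joubert_X_injective h2S))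
      (prodDifferences_ne_zero_iff.2 (MvPolynomial.joubertIterate_X_injective h2S)))
  rw [map_mul, map_prodDifferences, map_prodDifferences] at hθ
  simp only [map_joubert, map_joubertIterate, MvPolynomial.eval_X] at hθ
  have hz := prodDifferences_ne_zero_iff.1 (left_ne_zero_of_mul hθ)
  have hy := prodDifferences_ne_zero_iff.1 (right_ne_zero_of_mul hθ)
  obtain ⟨y, hy'⟩ := exists_conjugates_eq_of_equivariant (by norm_num) σ joubertIterate
    (fun τ x i => (map_joubertIterate (τ : S →+* S) x i).symm) joubertIterate_comp_perm θ
  have hy'' : (fun i => σ i y) = joubertIterate fun j => σ j θ := funext hy'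
  refine exists_sextic_normal_form_of_conjugates hn h2S σ (x := y) ?_ ?_ ?_ ?_
  · rw [hy'']; exact hy
  · rw [hy'']; exact sext1_joubertIterate _
  · rw [hy'']; exact sext3_joubertIterate _
  · intro i j hij
    have ht : totalOfTotals i ≠ totalOfTotals j := by revert i j; decide
    rw [hy', hy', joubertIterate, joubertIterate, joubert_add _ ht]
    refine mul_ne_zero ?_ (synthemeProd_ne_zero hz ht)
    rw [show (4 : S) = 2 * 2 by norm_num]
    exact mul_ne_zero h2S h2S

end JoubertIterate

/-! ### The canonizant of a quintic and its resultant -/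

section Canonizant

variable {R : Type*} [CommRing R]

theorem Matrix.det_fin_five_of_symm
    (m00 m01 m02 m03 m04 m11 m12 m13 m14 m22 m23 m24 m33 m34 m44 : R) :
    Matrix.det !![m00, m01, m02, m03, m04;
    m01, m11, m12, m13, m14;
    m02, m12, m22, m23, m24;
    m03, m13, m23, m33, m34;
    m04, m14, m24, m34, m44] =
    m00 * (m11 * (m22 * (m33 * m44 - m34 * m34) - m23 * (m23 * m44 - m34 * m24) + m24 *
    (m23 * m34 - m33 * m24)) - m12 * (m12 * (m33 * m44 - m34 * m34) - m23 * (m13 * m44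
    - m34 * m14) + m24 * (m13 * m34 - m33 * m14)) + m13 * (m12 * (m23 * m44 - m34 *
    m24) - m22 * (m13 * m44 - m34 * m14) + m24 * (m13 * m24 - m23 * m14)) - m14 * (m12
    * (m23 * m34 - m33 * m24) - m22 * (m13 * m34 - m33 * m14) + m23 * (m13 * m24 - m23
    * m14))) - m01 * (m01 * (m22 * (m33 * m44 - m34 * m34) - m23 * (m23 * m44 - m34 *
    m24) + m24 * (m23 * m34 - m33 * m24)) - m12 * (m02 * (m33 * m44 - m34 * m34) - m23
    * (m03 * m44 - m34 * m04) + m24 * (m03 * m34 - m33 * m04)) + m13 * (m02 * (m23 *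
    m44 - m34 * m24) - m22 * (m03 * m44 - m34 * m04) + m24 * (m03 * m24 - m23 *
    m04)) - m14 * (m02 * (m23 * m34 - m33 * m24) - m22 * (m03 * m34 - m33 * m04) + m23
    * (m03 * m24 - m23 * m04))) + m02 * (m01 * (m12 * (m33 * m44 - m34 * m34) - m23 *
    (m13 * m44 - m34 * m14) + m24 * (m13 * m34 - m33 * m14)) - m11 * (m02 * (m33 * m44
    - m34 * m34) - m23 * (m03 * m44 - m34 * m04) + m24 * (m03 * m34 - m33 * m04)) +
    m13 * (m02 * (m13 * m44 - m34 * m14) - m12 * (m03 * m44 - m34 * m04) + m24 * (m03 *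
    m14 - m13 * m04)) - m14 * (m02 * (m13 * m34 - m33 * m14) - m12 * (m03 * m34 - m33
    * m04) + m23 * (m03 * m14 - m13 * m04))) - m03 * (m01 * (m12 * (m23 * m44 - m34 *
    m24) - m22 * (m13 * m44 - m34 * m14) + m24 * (m13 * m24 - m23 * m14)) - m11 * (m02
    * (m23 * m44 - m34 * m24) - m22 * (m03 * m44 - m34 * m04) + m24 * (m03 * m24 - m23
    * m04)) + m12 * (m02 * (m13 * m44 - m34 * m14) - m12 * (m03 * m44 - m34 * m04) +
    m24 * (m03 * m14 - m13 * m04)) - m14 * (m02 * (m13 * m24 - m23 * m14) - m12 * (m03 *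
    m24 - m23 * m04) + m22 * (m03 * m14 - m13 * m04))) + m04 * (m01 * (m12 * (m23 *
    m34 - m33 * m24) - m22 * (m13 * m34 - m33 * m14) + m23 * (m13 * m24 - m23 *
    m14)) - m11 * (m02 * (m23 * m34 - m33 * m24) - m22 * (m03 * m34 - m33 * m04) + m23
    * (m03 * m24 - m23 * m04)) + m12 * (m02 * (m13 * m34 - m33 * m14) - m12 * (m03 *
    m34 - m33 * m04) + m23 * (m03 * m14 - m13 * m04)) - m13 * (m02 * (m13 * m24 - m23
    * m14) - m12 * (m03 * m24 - m23 * m04) + m22 * (m03 * m14 - m13 * m04))) := by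
  simp [Matrix.det_succ_row_zero, Fin.sum_univ_succ, Fin.succAbove]
  ring

/-- The Bezout matrix of the quintic `X ^ 5 + p X ^ 3 + q X ^ 2 + r X + s` and the quartic
`a + b X + c X ^ 2 + d X ^ 3 + e X ^ 4`. -/
def bezoutQuintic (p q r s a b c d e : R) : Matrix (Fin 5) (Fin 5) R :=
  !![r * a - s * b, q * a - s * c, p * a - s * d, -s * e, a;
    q * a - s * c, p * a + q * b - r * c - s * d, p * b - r * d - s * e, a - r * e, b;
    p * a - s * d, p * b - r * d - s * e, a + p * c - q * d - r * e, b - q * e, c;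
    -s * e, a - r * e, b - q * e, c - p * e, d;
    a, b, c, d, e]

/-- The coefficients of the canonizant of the quintic `X ^ 5 + p X ^ 3 + q X ^ 2 + r X + s`. -/
def canonizant0 (p q r s : R) : R := 10 * p ^ 2 * s - 4 * p * q * r + q ^ 3
def canonizant1 (p q r s : R) : R := -2 * p ^ 2 * r + p * q ^ 2 - 100 * q * s + 40 * r ^ 2
def canonizant2 (p q r s : R) : R := p ^ 2 * q - 100 * p * s + 20 * q * r
def canonizant3 (p q r : R) : R := p ^ 3 - 20 * p * r + 10 * q ^ 2

/-- The resultant of a quintic with `y` times its derivative minus its canonizant. -/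
def canonizantResultant (p q r s y : R) : R :=
  (bezoutQuintic p q r s (y * r - canonizant0 p q r s) (y * (2 * q) - canonizant1 p q r s)
    (y * (3 * p) - canonizant2 p q r s) (-canonizant3 p q r) (y * 5)).det

-- Absence of y⁴ and y² says that the values j(θ)/f'(θ) have e₁ = e₃ = 0. For e₁ this is Euler's
-- formula, as deg j < 4; for e₃ it is special to the canonizant.
set_option maxHeartbeats 4000000 in
theorem canonizantResultant_add_neg (p q r s y : R) :
    canonizantResultant p q r s y + canonizantResultant p q r s (-y) =
      2 * canonizantResultant p q r s 0 := by
  simp only [canonizantResultant, bezoutQuintic, Matrix.det_fin_five_of_symm, canonizant0,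
    canonizant1, canonizant2, canonizant3]
  ring

end Canonizant

/-! ### The resultant as a polynomial -/

section CanonizantPoly

variable {R S : Type*} [CommRing R] [CommRing S]

theorem map_canonizantResultant (f : R →+* S) (p q r s y : R) :
    f (canonizantResultant p q r s y) = canonizantResultant (f p) (f q) (f r) (f s) (f y) := by
  rw [canonizantResultant, canonizantResultant, RingHom.map_det]
  congr 1
  ext i j
  fin_cases i <;> fin_cases j <;>
    simp [bezoutQuintic, canonizant0, canonizant1, canonizant2, canonizant3, map_ofNat]

/-- The resultant `canonizantResultant` as a polynomial in its last argument. -/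
noncomputable def canonizantPoly (p q r s : R) : R[X] :=
  canonizantResultant (C p) (C q) (C r) (C s) X

theorem eval_canonizantPoly (p q r s y : R) :
    eval y (canonizantPoly p q r s) = canonizantResultant p q r s y := by
  rw [canonizantPoly, ← coe_evalRingHom, map_canonizantResultant]
  simp

theorem map_canonizantPoly (f : R →+* S) (p q r s : R) :
    (canonizantPoly p q r s).map f = canonizantPoly (f p) (f q) (f r) (f s) := by
  rw [canonizantPoly, ← coe_mapRingHom, map_canonizantResultant]
  simp [canonizantPoly]

theorem canonizantResultant_neg_X (p q r s : R) :
    canonizantResultant (C p) (C q) (C r) (C s) (-X) = (canonizantPoly p q r s).comp (-X) := by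
  have h := map_canonizantResultant (compRingHom (-X : R[X])) (C p) (C q) (C r) (C s) X
  simp only [coe_compRingHom_apply, C_comp, X_comp] at h
  exact h.symm

theorem canonizantResultant_C_zero (p q r s : R) :
    canonizantResultant (C p) (C q) (C r) (C s) 0 = C (canonizantResultant p q r s 0) := by
  have h := map_canonizantResultant (C : R →+* R[X]) p q r s 0
  rw [map_zero] at h
  exact h.symm

theorem canonizantPoly_eq_det (p q r s : R) : canonizantPoly p q r s =
    ((X : R[X]) • (bezoutQuintic p q r s r (2 * q) (3 * p) 0 5).map C +
      (bezoutQuintic p q r s (-canonizant0 p q r s) (-canonizant1 p q r s) (-canonizant2 p q r s)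
        (-canonizant3 p q r) 0).map C).det := by
  rw [canonizantPoly, canonizantResultant]
  congr 1
  ext1 i j
  fin_cases i <;> fin_cases j <;>
    simp [bezoutQuintic, canonizant0, canonizant1, canonizant2, canonizant3, map_ofNat] <;> ring

theorem natDegree_canonizantPoly_le (p q r s : R) : (canonizantPoly p q r s).natDegree ≤ 5 := by
  rw [canonizantPoly_eq_det]
  exact natDegree_det_X_add_C_le _ _

theorem coeff_canonizantPoly_eq_zero_of_charZero [IsDomain R] [CharZero R] (p q r s : R) {k : ℕ}
    (hk : Even k) (h0 : k ≠ 0) : (canonizantPoly p q r s).coeff k = 0 := by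
  have h : canonizantPoly p q r s + (canonizantPoly p q r s).comp (-X) =
      2 * C (canonizantResultant p q r s 0) := by
    have h := canonizantResultant_add_neg (C p) (C q) (C r) (C s) X
    have h1 := canonizantResultant_neg_X p q r s
    have h2 := canonizantResultant_C_zero p q r s
    generalize canonizantResultant (C p) (C q) (C r) (C s) (-X) = A at h h1
    generalize canonizantResultant (C p) (C q) (C r) (C s) 0 = B at h h2
    rw [← h1, ← h2]
    exact h
  have hc := congrArg (fun P => coeff P k) h
  rw [show (-X : R[X]) = C (-1) * X by simp] at hc
  simp only [coeff_add, comp_C_mul_X_coeff, hk.neg_one_pow, mul_one, coeff_ofNat_mul,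
    coeff_C_of_ne_zero h0, mul_zero, ← two_mul] at hc
  exact (mul_eq_zero.1 hc).resolve_left two_ne_zero

/-- Specialisation from ℤ[p, q, r, s], where the factor 2 can be cancelled; this covers
characteristic 2. -/
theorem coeff_canonizantPoly_eq_zero (p q r s : R) {k : ℕ} (hk : Even k) (h0 : k ≠ 0) :
    (canonizantPoly p q r s).coeff k = 0 := by
  have hu := coeff_canonizantPoly_eq_zero_of_charZero (R := MvPolynomial (Fin 4) ℤ)
    (.X 0) (.X 1) (.X 2) (.X 3) hk h0
  have hm := map_canonizantPoly (MvPolynomial.eval₂Hom (Int.castRingHom R) ![p, q, r, s])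
    (.X 0) (.X 1) (.X 2) (.X 3)
  simp only [MvPolynomial.coe_eval₂Hom, MvPolynomial.eval₂_X] at hm
  have hp : canonizantPoly (![p, q, r, s] 0) (![p, q, r, s] 1) (![p, q, r, s] 2)
    (![p, q, r, s] 3) = canonizantPoly p q r s := rfl
  rw [← hp, ← hm, coeff_map, hu, map_zero]

theorem canonizantResultant_eq (p q r s y : R) : canonizantResultant p q r s y =
    (canonizantPoly p q r s).coeff 5 * y ^ 5 + (canonizantPoly p q r s).coeff 3 * y ^ 3 +
      (canonizantPoly p q r s).coeff 1 * y + (canonizantPoly p q r s).coeff 0 := by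
  rw [← eval_canonizantPoly, eval_eq_sum_range' (n := 6)
    (Nat.lt_succ_of_le (natDegree_canonizantPoly_le p q r s))]
  simp only [Finset.sum_range_succ, Finset.sum_range_zero,
    coeff_canonizantPoly_eq_zero p q r s (k := 2) (by decide) (by decide),
    coeff_canonizantPoly_eq_zero p q r s (k := 4) (by decide) (by decide)]
  ring

theorem canonizantPoly_zero : canonizantPoly (0 : R) 0 0 0 = 0 := by
  simp [canonizantPoly, canonizantResultant, bezoutQuintic, Matrix.det_fin_five_of_symm,
    canonizant0, canonizant1, canonizant2, canonizant3]

/-- The test quintic X⁵ + X: the value is 2¹² · 5⁴, nonzero outside characteristics 2 and 5. -/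
theorem coeff_one_canonizantPoly_bring :
    (canonizantPoly (0 : R) 0 1 0).coeff 1 = 2560000 := by
  have : canonizantPoly (0 : R) 0 1 0 = 256 * X ^ 5 + 2560000 * X := by
    simp [canonizantPoly, canonizantResultant, bezoutQuintic, Matrix.det_fin_five_of_symm,
      canonizant0, canonizant1, canonizant2, canonizant3]
    ring
  rw [this]
  simp [coeff_X_pow, coeff_ofNat_mul]

/-- The test quintic X⁵ + X³ + X² for characteristic 2: the value is odd. -/
theorem coeff_one_canonizantPoly_one_one :
    (canonizantPoly (1 : R) 1 0 0).coeff 1 = 187 := by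
  have : canonizantPoly (1 : R) 1 0 0 = 31 * X ^ 3 + 187 * X + 899 := by
    simp [canonizantPoly, canonizantResultant, bezoutQuintic, Matrix.det_fin_five_of_symm,
      canonizant0, canonizant1, canonizant2, canonizant3]
    ring
  rw [this]
  simp [coeff_X_pow, coeff_ofNat_mul]

/-- Each row of the Bezout matrix, paired with (1, θ, …, θ⁴), is a combination of f(θ) and g(θ),
where g = y f' - j. At a common root this nonzero vector lies in the kernel. -/
theorem canonizantResultant_eq_zero [IsDomain R] {p q r s θ y : R}
    (hf : θ ^ 5 + p * θ ^ 3 + q * θ ^ 2 + r * θ + s = 0)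
    (hy : y * (5 * θ ^ 4 + 3 * p * θ ^ 2 + 2 * q * θ + r) = canonizant0 p q r s +
      canonizant1 p q r s * θ + canonizant2 p q r s * θ ^ 2 + canonizant3 p q r * θ ^ 3) :
    canonizantResultant p q r s y = 0 := by
  rw [canonizantResultant]
  generalize canonizant0 p q r s = j0 at *
  generalize canonizant1 p q r s = j1 at *
  generalize canonizant2 p q r s = j2 at *
  generalize canonizant3 p q r = j3 at *
  by_contra hne
  have h := Matrix.eq_zero_of_mulVec_eq_zero hne (v := ![1, θ, θ ^ 2, θ ^ 3, θ ^ 4]) (by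
    generalize ha : y * r - j0 = a
    generalize hb : y * (2 * q) - j1 = b
    generalize hc : y * (3 * p) - j2 = c
    generalize hd : -j3 = d
    generalize he : y * 5 = e
    have hg : a + b * θ + c * θ ^ 2 + d * θ ^ 3 + e * θ ^ 4 = 0 := by
      rw [← ha, ← hb, ← hc, ← hd, ← he]; linear_combination hy
    funext i
    fin_cases i <;> simp [bezoutQuintic, Matrix.mulVec, dotProduct, Fin.sum_univ_succ]
    · linear_combination (θ ^ 4 + p * θ ^ 2 + q * θ + r) * hg -
        (b + c * θ + d * θ ^ 2 + e * θ ^ 3) * hf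
    · linear_combination (θ ^ 3 + p * θ + q) * hg - (c + d * θ + e * θ ^ 2) * hf
    · linear_combination (θ ^ 2 + p) * hg - (d + e * θ) * hf
    · linear_combination θ * hg - e * hf
    · linear_combination hg)
  exact one_ne_zero (congrFun h 0)

end CanonizantPoly

/-! ### Quintics over infinite fields -/

section InfiniteQuintic

theorem Polynomial.Monic.exists_eq_prod_X_sub_C {E : Type*} [Field E] [IsAlgClosed E] {f : E[X]}
    (hf : f.Monic) {n : ℕ} (hn : f.natDegree = n) : ∃ v : Fin n → E, f = ∏ i, (X - C (v i)) := by
  have hs := IsAlgClosed.splits f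
  have hprod := hs.eq_prod_roots_of_monic hf
  have hcard := hs.natDegree_eq_card_roots
  obtain ⟨l, hl⟩ := Quot.exists_rep f.roots
  have hl' : (l : Multiset E) = f.roots := hl
  obtain rfl : l.length = n := by rw [← hn, hcard, ← hl', Multiset.coe_card]
  refine ⟨fun i => l[i.1], ?_⟩
  rw [Fin.prod_univ_fun_getElem l fun a => X - C a]
  conv_lhs => rw [hprod, ← hl', Multiset.map_coe, Multiset.prod_coe]

theorem exists_quint_eq {E : Type*} [Field E] [IsAlgClosed E] (p q r s : E) :
    ∃ v : Fin 5 → E, quint1 v = 0 ∧ quint2 v = p ∧ -quint3 v = q ∧ quint4 v = r ∧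
      -quint5 v = s := by
  have hdeg : (X ^ 5 + C p * X ^ 3 + C q * X ^ 2 + C r * X + C s : E[X]).natDegree = 5 := by
    compute_degree!
  have hmon : (X ^ 5 + C p * X ^ 3 + C q * X ^ 2 + C r * X + C s : E[X]).Monic := by monicity!
  obtain ⟨v, hv⟩ := hmon.exists_eq_prod_X_sub_C hdeg
  rw [prod_X_sub_C_fin_five] at hv
  have hk := fun k => congrArg (fun P => coeff P k) hv
  have k0 := hk 0
  have k1 := hk 1
  have k2 := hk 2
  have k3 := hk 3
  have k4 := hk 4
  simp [coeff_X, coeff_X_pow, coeff_C] at k0 k1 k2 k3 k4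
  exact ⟨v, k4, k3.symm, k2.symm, k1.symm, k0.symm⟩

variable {K L : Type*} [Field K] [Field L] [Algebra K L] [FiniteDimensional K L]

theorem exists_quintic_normal_form_of_canonizant (hn : Module.finrank K L = 5) (h5 : (5 : K) ≠ 0)
    {θ : L} (hθ : K⟮θ⟯ = ⊤) {p q r s : K} (hc : (canonizantPoly p q r s).coeff 1 ≠ 0)
    (hf : θ ^ 5 + algebraMap K L p * θ ^ 3 + algebraMap K L q * θ ^ 2 + algebraMap K L r * θ +
      algebraMap K L s = 0) :
    ∃ (x : L) (b c : K), K⟮x⟯ = ⊤ ∧ minpoly K x = X ^ 5 + C b * X ^ 3 + C c * X + C c := by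
  set ι := algebraMap K L with hι
  have hquart : ∀ a b c d e : K, ι a + ι b * θ + ι c * θ ^ 2 + ι d * θ ^ 3 + ι e * θ ^ 4 = 0 →
      a = 0 ∧ b = 0 ∧ c = 0 ∧ d = 0 ∧ e = 0 := by
    intro a b c d e h
    by_contra hne
    refine aeval_ne_zero_of_natDegree_lt hθ
      (P := C a + C b * X + C c * X ^ 2 + C d * X ^ 3 + C e * X ^ 4) ?_ ?_ (by simpa using h)
    · intro h0
      apply hne
      have hk := fun k => congrArg (fun P => coeff P k) h0
      have k0 := hk 0
      have k1 := hk 1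
      have k2 := hk 2
      have k3 := hk 3
      have k4 := hk 4
      simp [coeff_X, coeff_X_pow, coeff_C] at k0 k1 k2 k3 k4
      exact ⟨k0, k1, k2, k3, k4⟩
    · rw [hn]
      refine Nat.lt_succ_of_le ?_
      compute_degree!
  set δ := 5 * θ ^ 4 + 3 * ι p * θ ^ 2 + 2 * ι q * θ + ι r with hδ
  have hδ0 : δ ≠ 0 := by
    intro h
    refine h5 (hquart r (2 * q) (3 * p) 0 5 ?_).2.2.2.2
    rw [← h, hδ]
    simp only [map_mul, map_ofNat, map_zero]
    ring
  set j := ι (canonizant0 p q r s) + ι (canonizant1 p q r s) * θ +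
    ι (canonizant2 p q r s) * θ ^ 2 + ι (canonizant3 p q r) * θ ^ 3 with hj
  have hmap : ∀ k, ι ((canonizantPoly p q r s).coeff k) =
      (canonizantPoly (ι p) (ι q) (ι r) (ι s)).coeff k := fun k => by
    rw [← map_canonizantPoly, coeff_map]
  have hres : canonizantResultant (ι p) (ι q) (ι r) (ι s) (j / δ) = 0 := by
    refine canonizantResultant_eq_zero hf ?_
    rw [← hδ, div_mul_cancel₀ _ hδ0, hj]
    simp [canonizant0, canonizant1, canonizant2, canonizant3, map_ofNat]
  rw [canonizantResultant_eq, ← hmap, ← hmap, ← hmap, ← hmap] at hres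
  -- If the quotient were a ∈ K, the polynomial a f' - j of degree at most 4 would vanish at θ,
  -- hence identically. Then a = 0 and j = 0, and the resultant is a multiple of y⁵, against `hc`.
  have hy : j / δ ∉ (algebraMap K L).range := by
    rintro ⟨a, ha⟩
    rw [eq_div_iff hδ0, ← sub_eq_zero] at ha
    have h := hquart (a * r - canonizant0 p q r s) (a * (2 * q) - canonizant1 p q r s)
      (a * (3 * p) - canonizant2 p q r s) (-canonizant3 p q r) (a * 5) (by
        rw [← ha, hj, hδ]
        simp only [map_mul, map_ofNat, map_sub, map_neg]
        ring)
    obtain ⟨h0, h1, h2, h3, h4⟩ := h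
    obtain rfl : a = 0 := (mul_eq_zero.1 h4).resolve_right h5
    rw [zero_mul, zero_sub, neg_eq_zero] at h0 h1 h2
    rw [neg_eq_zero] at h3
    apply hc
    rw [canonizantPoly_eq_det, h0, h1, h2, h3]
    have hz : bezoutQuintic p q r s (-0) (-0) (-0) (-0) 0 = 0 := by
      ext i j; fin_cases i <;> fin_cases j <;> simp [bezoutQuintic]
    rw [hz, Matrix.map_zero _ (map_zero C), add_zero, Matrix.det_smul, coeff_X_pow_mul']
    simp
  have hgen := adjoin_eq_top_of_finrank_prime (by rw [hn]; norm_num) hy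
  set A := (canonizantPoly p q r s).coeff 5
  set B := (canonizantPoly p q r s).coeff 3
  set D := (canonizantPoly p q r s).coeff 1
  set F := (canonizantPoly p q r s).coeff 0
  have hA : A ≠ 0 := by
    intro hA
    refine aeval_ne_zero_of_natDegree_lt hgen (P := C B * X ^ 3 + C D * X + C F) ?_ ?_ ?_
    · intro h0
      have h1 := congrArg (fun P => coeff P 1) h0
      simp [coeff_X_pow, coeff_C] at h1
      exact hc h1
    · rw [hn]
      refine lt_of_le_of_lt (b := 3) ?_ (by norm_num)
      compute_degree!
    · simp only [map_add, map_mul, map_pow, aeval_X, aeval_C]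
      rw [hA, map_zero] at hres
      linear_combination hres
  refine exists_quintic_normal_form hn hgen (b := B / A) (d := D / A) (e := F / A)
    (div_ne_zero hc hA) ?_
  have key : ∀ a b d f y : L, a ≠ 0 → a * y ^ 5 + b * y ^ 3 + d * y + f = 0 →
      y ^ 5 + b / a * y ^ 3 + d / a * y + f / a = 0 := by
    intro a b d f y ha h
    field_simp
    linear_combination h
  rw [map_div₀, map_div₀, map_div₀]
  exact key _ _ _ _ _ ((_root_.map_ne_zero ι).2 hA) hres

/-- A scalar b has trace zero when 5b = 0, and then its polynomial is X⁵ - b⁵; `hconst` makes G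
vanish there, so the element found is not a scalar. -/
theorem exists_quintic_generator_aeval_ne_zero [Infinite K] [Algebra.IsSeparable K L]
    (hn : Module.finrank K L = 5) (G : MvPolynomial (Fin 4) ℤ) {E : Type*} [Field E] [IsAlgClosed E]
    [Algebra K E] (hconst : ∀ s : E, 5 * s = 0 → MvPolynomial.aeval ![0, 0, 0, s] G = 0)
    {p q r s : E} (hG : MvPolynomial.aeval ![p, q, r, s] G ≠ 0) :
    ∃ (θ : L) (p q r s : K), K⟮θ⟯ = ⊤ ∧ θ ^ 5 + algebraMap K L p * θ ^ 3 + algebraMap K L q * θ ^ 2 +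
      algebraMap K L r * θ + algebraMap K L s = 0 ∧ MvPolynomial.aeval ![p, q, r, s] G ≠ 0 := by
  have hcard : Fintype.card (L →ₐ[K] E) = 5 := by rw [AlgHom.card, hn]
  let σ : Fin 5 ≃ (L →ₐ[K] E) := (Fintype.equivFinOfCardEq hcard).symm
  let e : ∀ {R : Type _} [CommRing R], (Fin 5 → R) → Fin 4 → R :=
    fun v => ![quint2 v, -quint3 v, quint4 v, -quint5 v]
  let P : MvPolynomial (Fin 5) E := MvPolynomial.aeval (e MvPolynomial.X) G
  have hP : ∀ v : Fin 5 → E, MvPolynomial.eval v P = MvPolynomial.aeval (e v) G := by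
    intro v
    have h := MvPolynomial.map_aeval (e (MvPolynomial.X : Fin 5 → MvPolynomial (Fin 5) E))
      (MvPolynomial.eval v) G
    rw [h, MvPolynomial.aeval_def, MvPolynomial.coe_eval₂Hom]
    congr 1
    · exact RingHom.ext_int _ _
    · funext i
      fin_cases i <;> simp [e, quint2, quint3, quint4, quint5]
  obtain ⟨v, hv1, hv2, hv3, hv4, hv5⟩ := exists_quint_eq p q r s
  have hev : e v = ![p, q, r, s] := by simp only [e, hv2, hv3, hv4, hv5]
  obtain ⟨θ, hθ0, hθ⟩ := exists_trace_zero_eval_embeddings_ne_zero hn σ P v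
    (by rw [Fin.sum_univ_five]; exact hv1) (by rw [hP, hev]; exact hG)
  rw [hP] at hθ
  have hθ1 : quint1 (fun i => σ i θ) = 0 := by rw [← hθ0, Fin.sum_univ_five]; rfl
  have hmem : θ ∉ (algebraMap K L).range := by
    rintro ⟨a, rfl⟩
    apply hθ
    simp only [AlgHom.commutes] at hθ1 ⊢
    generalize algebraMap K E a = b at hθ1 ⊢
    have h5 : 5 * b = 0 := by rw [← hθ1, quint1]; ring
    have : e (fun _ => b) = ![0, 0, 0, -b ^ 5] := by
      funext i
      fin_cases i <;> simp [e, quint2, quint3, quint4, quint5]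
      · linear_combination 2 * b * h5
      · linear_combination -2 * b ^ 2 * h5
      · linear_combination b ^ 3 * h5
      · ring
    rw [this]
    exact hconst _ (by linear_combination -b ^ 4 * h5)
  have hgen := adjoin_eq_top_of_finrank_prime (by rw [hn]; norm_num) hmem
  obtain ⟨-, hmin⟩ := minpoly_map_eq_prod hn (fun i => σ i)
    (injective_apply_of_adjoin_eq_top σ.injective hgen)
  rw [prod_X_sub_C_fin_five, hθ1] at hmin
  have hdeg : (minpoly K θ).natDegree = 5 :=
    hn ▸ (Field.primitive_element_iff_minpoly_natDegree_eq K θ).1 hgen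
  have hmon := minpoly.monic (Algebra.IsIntegral.isIntegral (R := K) θ)
  have hc : ∀ k, algebraMap K E ((minpoly K θ).coeff k) =
      coeff ((minpoly K θ).map (algebraMap K E)) k := fun k => (coeff_map _ _).symm
  rw [hmin] at hc
  have k0 := hc 0
  have k1 := hc 1
  have k2 := hc 2
  have k3 := hc 3
  have k4 := hc 4
  simp [coeff_X, coeff_X_pow, coeff_C] at k0 k1 k2 k3 k4
  refine ⟨θ, (minpoly K θ).coeff 3, (minpoly K θ).coeff 2, (minpoly K θ).coeff 1,
    (minpoly K θ).coeff 0, hgen, ?_, ?_⟩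
  · have h5 : (minpoly K θ).coeff 5 = 1 := by rw [← hdeg]; exact hmon
    have := minpoly.aeval K θ
    rw [aeval_eq_sum_range, hdeg] at this
    simp only [Finset.sum_range_succ, Finset.sum_range_zero, h5, k4, Algebra.smul_def, map_one,
      map_zero] at this
    linear_combination this
  · intro h0
    apply hθ
    have h := congrArg (algebraMap K E) h0
    rw [map_zero, MvPolynomial.map_aeval] at h
    rw [← h, MvPolynomial.aeval_def, MvPolynomial.coe_eval₂Hom]
    congr 1
    · exact RingHom.ext_int _ _
    · funext i
      fin_cases i <;> simp [e, k0, k1, k2, k3]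

theorem aeval_coeff_canonizantPoly {R : Type*} [CommRing R] (p q r s : R) (k : ℕ) :
    MvPolynomial.aeval ![p, q, r, s]
      ((canonizantPoly (R := MvPolynomial (Fin 4) ℤ) (MvPolynomial.X 0) (MvPolynomial.X 1)
        (MvPolynomial.X 2) (MvPolynomial.X 3)).coeff k) =
    (canonizantPoly p q r s).coeff k := by
  have h := map_canonizantPoly
    (MvPolynomial.aeval (R := ℤ) ![p, q, r, s] : MvPolynomial (Fin 4) ℤ →+* R)
    (MvPolynomial.X 0) (MvPolynomial.X 1) (MvPolynomial.X 2) (MvPolynomial.X 3)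
  simp only [RingHom.coe_coe, MvPolynomial.aeval_X] at h
  have hp : canonizantPoly (![p, q, r, s] 0) (![p, q, r, s] 1) (![p, q, r, s] 2)
    (![p, q, r, s] 3) = canonizantPoly p q r s := rfl
  rw [← hp, ← h, coeff_map, RingHom.coe_coe]

theorem exists_quintic_normal_form_of_infinite [Infinite K] [Algebra.IsSeparable K L]
    (hn : Module.finrank K L = 5) :
    ∃ (x : L) (b c : K), K⟮x⟯ = ⊤ ∧ minpoly K x = X ^ 5 + C b * X ^ 3 + C c * X + C c := by
  let E := AlgebraicClosure K
  by_cases h5 : (5 : K) = 0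
  · have h5E : (5 : E) = 0 := by rw [← map_ofNat (algebraMap K E), h5, map_zero]
    -- In characteristic 5 a translation creates no X⁴ term, so translating by q/(3p) removes X².
    -- The factor 3p clears denominators, and the new coefficient of X is 27p³(3pr - q²).
    obtain ⟨θ, p, q, r, s, hgen, hf, hG⟩ := exists_quintic_generator_aeval_ne_zero hn
      (MvPolynomial.X 0 * (3 * MvPolynomial.X 0 * MvPolynomial.X 2 - MvPolynomial.X 1 ^ 2)) (E := E) (fun s _ => by simp)
      (p := 1) (q := 0) (r := 1) (s := 0) (by
        simp [map_ofNat]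
        intro h
        exact one_ne_zero (by linear_combination 2 * h - h5E : (1 : E) = 0))
    simp [map_ofNat] at hG
    obtain ⟨hp, hd⟩ := hG
    have h3 : (3 : K) ≠ 0 := fun h => one_ne_zero (by linear_combination 2 * h - h5 : (1 : K) = 0)
    have hp3 : 3 * p ≠ 0 := mul_ne_zero h3 hp
    have h5L : (5 : L) = 0 := by rw [← map_ofNat (algebraMap K L), h5, map_zero]
    have hx : algebraMap K L (3 * p) * θ + algebraMap K L q ∉ (algebraMap K L).range := by
      rintro ⟨a, ha⟩
      refine aeval_ne_zero_of_natDegree_lt hgen (P := C (3 * p) * X + C (q - a)) ?_ ?_ ?_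
      · intro h0
        have h1 := congrArg (fun P => coeff P 1) h0
        simp only [coeff_add, coeff_C_mul, coeff_X_one, mul_one, coeff_C_succ, add_zero,
          coeff_zero] at h1
        exact hp3 h1
      · rw [hn]
        refine lt_of_le_of_lt (b := 1) ?_ (by norm_num)
        compute_degree!
      · simp only [map_add, map_mul, map_sub, aeval_X, aeval_C] at ha ⊢
        linear_combination -ha
    have hd' : 27 * p ^ 3 * (3 * p * r - q ^ 2) ≠ 0 := by
      rw [show (27 : K) = 3 ^ 3 by norm_num]
      exact mul_ne_zero (mul_ne_zero (pow_ne_zero _ h3) (pow_ne_zero _ hp)) hd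
    refine exists_quintic_normal_form hn
      (adjoin_eq_top_of_finrank_prime (by rw [hn]; norm_num) hx) (b := 9 * p ^ 3)
      (d := 27 * p ^ 3 * (3 * p * r - q ^ 2))
      (e := -q ^ 5 + 18 * p ^ 3 * q ^ 3 - 81 * p ^ 4 * q * r + 243 * p ^ 5 * s) hd' ?_
    simp only [map_add, map_mul, map_sub, map_neg, map_pow, map_ofNat]
    generalize algebraMap K L p = p' at *
    generalize algebraMap K L q = q' at *
    generalize algebraMap K L r = r' at *
    generalize algebraMap K L s = s' at *
    linear_combination (3 * p') ^ 5 * hf + ((3 * p' * θ + q') ^ 4 * q' -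
      2 * (3 * p' * θ + q') ^ 3 * q' ^ 2 + 2 * (3 * p' * θ + q') ^ 2 * q' ^ 3 -
      (3 * p' * θ + q') * q' ^ 4) * h5L
  · have h5E : (5 : E) ≠ 0 := by
      rw [← map_ofNat (algebraMap K E)]; exact (_root_.map_ne_zero _).2 h5
    by_cases h2 : (2 : E) = 0
    · obtain ⟨θ, p, q, r, s, hgen, hf, hG⟩ := exists_quintic_generator_aeval_ne_zero hn
        ((canonizantPoly (MvPolynomial.X 0) (MvPolynomial.X 1) (MvPolynomial.X 2)
          (MvPolynomial.X 3)).coeff 1) (E := E)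
        (fun s hs => by
          rw [(mul_eq_zero.1 hs).resolve_left h5E, aeval_coeff_canonizantPoly, canonizantPoly_zero,
            coeff_zero])
        (p := 1) (q := 1) (r := 0) (s := 0) (by
          rw [aeval_coeff_canonizantPoly, coeff_one_canonizantPoly_one_one]
          intro h
          exact one_ne_zero (by linear_combination h - 93 * h2 : (1 : E) = 0))
      rw [aeval_coeff_canonizantPoly] at hG
      exact exists_quintic_normal_form_of_canonizant hn h5 hgen hG hf
    · obtain ⟨θ, p, q, r, s, hgen, hf, hG⟩ := exists_quintic_generator_aeval_ne_zero hn
        ((canonizantPoly (MvPolynomial.X 0) (MvPolynomial.X 1) (MvPolynomial.X 2)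
          (MvPolynomial.X 3)).coeff 1) (E := E)
        (fun s hs => by
          rw [(mul_eq_zero.1 hs).resolve_left h5E, aeval_coeff_canonizantPoly, canonizantPoly_zero,
            coeff_zero])
        (p := 0) (q := 0) (r := 1) (s := 0) (by
          rw [aeval_coeff_canonizantPoly, coeff_one_canonizantPoly_bring,
            show (2560000 : E) = 2 ^ 12 * 5 ^ 4 by norm_num]
          exact mul_ne_zero (pow_ne_zero _ h2) (pow_ne_zero _ h5E))
      rw [aeval_coeff_canonizantPoly] at hG
      exact exists_quintic_normal_form_of_canonizant hn h5 hgen hG hf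

end InfiniteQuintic

/-! ### Cyclic sextics and finite fields -/

section CyclicSextic

variable {K L : Type*} [Field K] [Field L] [Algebra K L] [FiniteDimensional K L]

theorem exists_sextic_normal_form_of_cyclic (hn : Module.finrank K L = 6) (h2 : (2 : L) ≠ 0)
    (F : L →ₐ[K] L) (hF : Function.Injective fun i : Fin 6 => F ^ (i : ℕ)) (hF6 : F ^ 6 = 1) :
    ∃ (x : L) (b c d : K), K⟮x⟯ = ⊤ ∧
      minpoly K x = X ^ 6 + C b * X ^ 4 + C c * X ^ 2 + C d * X + C d := by
  have h6 : ∀ y, F (F (F (F (F (F y))))) = y := fun y => by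
    have := DFunLike.congr_fun hF6 y
    simpa [AlgHom.coe_pow] using this
  have hex : ∀ c : Fin 6 → L, c 0 ≠ 0 → ∃ w, c 0 * w + c 1 * F w + c 2 * F (F w) +
      c 3 * F (F (F w)) + c 4 * F (F (F (F w))) + c 5 * F (F (F (F (F w)))) ≠ 0 := by
    intro c hc
    obtain ⟨w, hw⟩ := exists_sum_mul_embeddings_ne_zero hF c 0 hc
    refine ⟨w, ?_⟩
    simpa [Fin.sum_univ_six, AlgHom.coe_pow] using hw
  -- These are the coefficients of (1 - T)²(1 + T³), giving m - F m for the m chosen below; the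
  -- alternating vector gives s.
  obtain ⟨w, hw⟩ := hex ![1, -2, 1, 1, -2, 1] (by simp)
  obtain ⟨v, hv⟩ := hex ![1, -1, 1, -1, 1, -1] (by simp)
  simp only [Matrix.cons_val] at hw hv
  obtain ⟨s, hs0, hs⟩ : ∃ s, s ≠ 0 ∧ F s = -s :=
    ⟨_, hv, by simp only [map_add, map_mul, map_one, map_neg, h6]; ring⟩
  obtain ⟨m, hm01, hm3, hm⟩ : ∃ m, F m - m ≠ 0 ∧ F (F (F m)) = m ∧ m + F m + F (F m) = 0 := by
    refine ⟨w - F w + F (F (F w)) - F (F (F (F w))), fun h => hw ?_, ?_, ?_⟩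
    · simp only [map_add, map_sub] at h
      linear_combination -h
    · simp only [map_add, map_sub, h6]; ring
    · simp only [map_add, map_sub, h6]; ring
  have hm0 : m ≠ 0 := by
    rintro rfl
    simp at hm01
  have hm10 : F m ≠ 0 := fun h => hm0 (by simpa using h)
  have hm20 : F (F m) ≠ 0 := fun h => hm10 (by simpa using h)
  have hm12 : F (F m) - F m ≠ 0 := fun h => hm01 (by
    rwa [← map_sub, map_eq_zero] at h)
  have hm02 : m - F (F m) ≠ 0 := fun h => hm12 (by
    nth_rw 1 [← hm3] at h; rwa [← map_sub, map_eq_zero] at h)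
  obtain ⟨u, hu⟩ := hex ![m, F m, F (F m), m, F m, F (F m)] hm0
  simp only [Matrix.cons_val] at hu
  obtain ⟨n, hn3, htr⟩ : ∃ n, F (F (F n)) = n ∧ m * n + F m * F n + F (F m) * F (F n) ≠ 0 :=
    ⟨u + F (F (F u)), by simp only [map_add, h6]; ring, fun h => hu (by
      simp only [map_add] at h; linear_combination h)⟩
  have hδ : F (s ^ 2) = s ^ 2 := by rw [map_pow, hs]; ring
  -- The t² term has coefficient s² Tr m = 0, so the equation is linear in t, with leading
  -- coefficient 2s² Tr(mn) ≠ 0.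
  obtain ⟨t, ht, hte⟩ : ∃ t, F t = t ∧ s ^ 2 * (m * (n + t) ^ 2 + F m * (F n + t) ^ 2 +
      F (F m) * (F (F n) + t) ^ 2) + m * F m * F (F m) = 0 := by
    refine ⟨(-(m * F m * F (F m)) / s ^ 2 - (m * n ^ 2 + F m * F n ^ 2 + F (F m) * F (F n) ^ 2)) /
      (2 * (m * n + F m * F n + F (F m) * F (F n))), ?_, ?_⟩
    · simp only [map_div₀, map_sub, map_add, map_mul, map_neg, hδ, hm3, hn3, map_ofNat]
      simp only [map_pow, hn3]
      congr 1 <;> ring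
    · generalize ht : (-(m * F m * F (F m)) / s ^ 2 -
        (m * n ^ 2 + F m * F n ^ 2 + F (F m) * F (F n) ^ 2)) /
        (2 * (m * n + F m * F n + F (F m) * F (F n))) = t
      rw [div_eq_iff (mul_ne_zero h2 htr), sub_eq_iff_eq_add, div_eq_iff (pow_ne_zero 2 hs0)] at ht
      linear_combination -ht + s ^ 2 * t ^ 2 * hm
  obtain ⟨ν, hν3, hνe⟩ : ∃ ν, F (F (F ν)) = ν ∧ s ^ 2 * (m * ν ^ 2 + F m * F ν ^ 2 +
      F (F m) * F (F ν) ^ 2) + m * F m * F (F m) = 0 :=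
    ⟨n + t, by simp [ht, hn3], by simpa [ht] using hte⟩
  have hν0 : ν ≠ 0 := by
    rintro rfl
    simp [hm0] at hνe
  have hν10 : F ν ≠ 0 := fun h => hν0 (by simpa using h)
  have hν20 : F (F ν) ≠ 0 := fun h => hν10 (by simpa using h)
  have hval : (fun i : Fin 6 => (F ^ (i : ℕ)) (m + ν * s)) = ![m + ν * s, F m + -F ν * s,
      F (F m) + F (F ν) * s, m + -ν * s, F m + F ν * s, F (F m) + -F (F ν) * s] := by
    funext i
    fin_cases i <;> simp [AlgHom.coe_pow, hs, hm3, hν3]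
  -- F³ fixes a and b and negates s, so a + bs and its image sum to 2a.
  have hfix : ∀ a b : L, F (F (F a)) = a → F (F (F b)) = b → a ≠ 0 → a + b * s ≠ 0 := by
    intro a b ha hb ha0 h0
    have h1 := congrArg (fun y => F (F (F y))) h0
    simp only [map_add, map_mul, ha, hb, hs, map_neg, map_zero] at h1
    exact mul_ne_zero h2 ha0 (by linear_combination h0 + h1)
  have hne : ∀ a b c d : L, F (F (F a)) = a → F (F (F b)) = b → F (F (F c)) = c →
      F (F (F d)) = d → a - c ≠ 0 → a + c ≠ 0 →
      a + b * s ≠ c + d * s ∧ a + b * s + (c + d * s) ≠ 0 := by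
    intro a b c d ha hb hc hd h1 h2
    refine ⟨fun h => hfix (a - c) (b - d) ?_ ?_ h1 (by linear_combination h),
      fun h => hfix (a + c) (b + d) ?_ ?_ h2 (by linear_combination h)⟩ <;>
    simp [ha, hb, hc, hd]
  have hop : ∀ a b : L, F (F (F a)) = a → F (F (F b)) = b → a ≠ 0 → b ≠ 0 →
      a + b * s ≠ a + -b * s ∧ a + b * s + (a + -b * s) ≠ 0 := by
    intro a b ha hb ha0 hb0
    refine ⟨fun h => mul_ne_zero h2 (mul_ne_zero hb0 hs0) (by linear_combination h),
      fun h => mul_ne_zero h2 ha0 (by linear_combination h)⟩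
  have hsym : ∀ a b : L, a ≠ b ∧ a + b ≠ 0 → b ≠ a ∧ b + a ≠ 0 := fun a b h =>
    ⟨h.1.symm, by rw [add_comm]; exact h.2⟩
  have h01 : m + F m ≠ 0 := fun h => hm20 (by linear_combination hm - h)
  have h02 : m + F (F m) ≠ 0 := fun h => hm10 (by linear_combination hm - h)
  have h12 : F (F m) + F m ≠ 0 := fun h => hm0 (by linear_combination hm - h)
  have hpair : ∀ i j : Fin 6, i < j → (F ^ (i : ℕ)) (m + ν * s) ≠ (F ^ (j : ℕ)) (m + ν * s) ∧
      (F ^ (i : ℕ)) (m + ν * s) + (F ^ (j : ℕ)) (m + ν * s) ≠ 0 := by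
    intro i j hij
    rw [show (F ^ (i : ℕ)) (m + ν * s) = _ from congrFun hval i,
      show (F ^ (j : ℕ)) (m + ν * s) = _ from congrFun hval j]
    have e0 : ∀ b d, F (F (F b)) = b → F (F (F d)) = d → _ := fun b d hb hd =>
      hsym _ _ (hne (F m) b m d (by rw [hm3]) hb hm3 hd hm01 (by rwa [add_comm]))
    have e1 : ∀ b d, F (F (F b)) = b → F (F (F d)) = d → _ := fun b d hb hd =>
      hsym _ _ (hne (F (F m)) b (F m) d (by rw [hm3]) hb (by rw [hm3]) hd hm12 h12)
    have e2 : ∀ b d, F (F (F b)) = b → F (F (F d)) = d → _ := fun b d hb hd =>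
      hne m b (F (F m)) d hm3 hb (by rw [hm3]) hd hm02 h02
    have f0 := hop m ν hm3 hν3 hm0 hν0
    have f1 := hop (F m) (F ν) (by rw [hm3]) (by rw [hν3]) hm10 hν10
    have f2 := hop (F (F m)) (F (F ν)) (by rw [hm3]) (by rw [hν3]) hm20 hν20
    fin_cases i <;> fin_cases j <;> first
      | exact absurd hij (by decide)
      | exact f0
      | exact f2
      | exact hsym _ _ f1
      | (refine e0 _ _ ?_ ?_ <;> simp [hν3])
      | (refine e1 _ _ ?_ ?_ <;> simp [hν3])
      | (refine e2 _ _ ?_ ?_ <;> simp [hν3])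
      | (refine hsym _ _ (e0 _ _ ?_ ?_) <;> simp [hν3])
      | (refine hsym _ _ (e1 _ _ ?_ ?_) <;> simp [hν3])
      | (refine hsym _ _ (e2 _ _ ?_ ?_) <;> simp [hν3])
  refine exists_sextic_normal_form_of_conjugates hn h2 (fun i : Fin 6 => F ^ (i : ℕ))
    (x := m + ν * s) ?_ ?_ ?_ ?_
  · intro i j hij
    rcases lt_trichotomy i j with h | h | h
    · exact absurd hij (hpair i j h).1
    · exact h
    · exact absurd hij.symm (hpair j i h).1
  · rw [hval]
    simp [sext1]
    linear_combination 2 * hm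
  · rw [hval]
    simp [sext3, quint3, quint2]
    linear_combination 2 * hνe + (2 * (m * F m + m * F (F m) + F m * F (F m)) -
      2 * s ^ 2 * (ν ^ 2 + F ν ^ 2 + F (F ν) ^ 2)) * hm
  · intro i j hij
    rcases lt_or_gt_of_ne hij with h | h
    · exact (hpair i j h).2
    · rw [add_comm]; exact (hpair j i h).2

theorem exists_sextic_normal_form_of_finite [Finite K] (hn : Module.finrank K L = 6)
    (h2 : ringChar K ≠ 2) :
    ∃ (x : L) (b c d : K), K⟮x⟯ = ⊤ ∧
      minpoly K x = X ^ 6 + C b * X ^ 4 + C c * X ^ 2 + C d * X + C d := by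
  have := Fintype.ofFinite K
  have : Finite L := Module.finite_of_finite K
  refine exists_sextic_normal_form_of_cyclic hn ?_ (FiniteField.frobeniusAlgHom K L) ?_ ?_
  · rw [← map_ofNat (algebraMap K L) 2, Ne, map_eq_zero]
    exact Ring.two_ne_zero h2
  · have := (FiniteField.bijective_frobeniusAlgHom_pow K L).injective
    rw [hn] at this
    exact this
  · rw [← hn, ← FiniteField.orderOf_frobeniusAlgHom K L, pow_orderOf_eq_one]

end CyclicSextic

/-! ### Cyclic quintics when τ lies in K -/

section CyclicQuintic

variable {K L : Type*} [Field K] [Field L] [Algebra K L] [FiniteDimensional K L]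

theorem exists_quintic_normal_form_of_cyclic (hn : Module.finrank K L = 5)
    (F : L →ₐ[K] L) (hF : Function.Injective fun i : Fin 5 => F ^ (i : ℕ)) (hF5 : F ^ 5 = 1)
    {t : K} (ht : t ^ 2 + t = 1) :
    ∃ (x : L) (b c : K), K⟮x⟯ = ⊤ ∧ minpoly K x = X ^ 5 + C b * X ^ 3 + C c * X + C c := by
  have h5 : ∀ y, F (F (F (F (F y)))) = y := fun y => by
    have := DFunLike.congr_fun hF5 y
    simpa [AlgHom.coe_pow] using this
  obtain ⟨τ, hFτ, hτ⟩ : ∃ τ, F τ = τ ∧ τ ^ 2 + τ = 1 :=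
    ⟨algebraMap K L t, F.commutes t, by rw [← map_pow, ← map_add, ht, map_one]⟩
  have hτ0 : τ ≠ 0 := by rintro rfl; simp at hτ
  have hex : ∀ c : Fin 5 → L, c ≠ 0 → ∃ w, c 0 * w + c 1 * F w + c 2 * F (F w) +
      c 3 * F (F (F w)) + c 4 * F (F (F (F w))) ≠ 0 := by
    intro c hc
    obtain ⟨i, hi⟩ := Function.ne_iff.1 hc
    obtain ⟨w, hw⟩ := exists_sum_mul_embeddings_ne_zero hF c i hi
    exact ⟨w, by simpa [Fin.sum_univ_five, AlgHom.coe_pow] using hw⟩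
  -- P = (F - 1)(F² - τ'F + 1) with τ' = -1 - τ; since F⁵ = 1, its image is killed by F² - τF + 1.
  obtain ⟨P, hP⟩ : ∃ P : L → L, ∀ u, P u = F (F (F u)) + τ * F (F u) - τ * F u - u :=
    ⟨_, fun _ => rfl⟩
  have hPF : ∀ u, F (F (P u)) = τ * F (P u) - P u := fun u => by
    simp only [hP, map_add, map_sub, map_mul, hFτ, h5]
    grind
  -- The square of τ times this quadratic form is e₄. Were the form zero on the image of P, its
  -- polarisation would be a linear relation between embeddings, forcing (τ² - 4)P = 0.
  obtain ⟨y, hy, hQ⟩ : ∃ y, F (F y) = τ * F y - y ∧ y ^ 2 + F y ^ 2 - τ * y * F y ≠ 0 := by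
    by_contra! H
    have hQ : ∀ u v, (2 * P u - τ * F (P u)) * P v + (2 * F (P u) - τ * P u) * F (P v) = 0 := by
      intro u v
      have e1 := H _ (hPF u)
      have e2 := H _ (hPF v)
      have hadd : P (u + v) = P u + P v := by simp only [hP, map_add]; ring
      have e3 := H _ (hPF (u + v))
      rw [hadd, map_add] at e3
      linear_combination e3 - e1 - e2
    have hc : ∀ u, 2 * P u = τ * F (P u) ∧ 2 * F (P u) = τ * P u := by
      intro u
      by_contra hne
      obtain ⟨v, hv⟩ := hex ![-(2 * P u - τ * F (P u)),
        -τ * (2 * P u - τ * F (P u)) - (2 * F (P u) - τ * P u),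
        τ * (2 * P u - τ * F (P u)) - τ * (2 * F (P u) - τ * P u),
        (2 * P u - τ * F (P u)) + τ * (2 * F (P u) - τ * P u), 2 * F (P u) - τ * P u]
        (fun h => hne ⟨sub_eq_zero.1 (neg_eq_zero.1 (congrFun h 0)),
          sub_eq_zero.1 (congrFun h 4)⟩)
      refine hv ?_
      simp only [Matrix.cons_val]
      rw [← hQ u v, hP v]
      simp only [map_add, map_sub, map_mul, hFτ]
      ring
    -- τ = 2 forces characteristic 5, where the form is (y - F y)². The value τ = -2 contradicts τ²
    -- + τ = 1.
    by_cases h4 : τ = 2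
    · obtain ⟨v, hv⟩ := hex ![-1, 1 - τ, 2 * τ, 1 - τ, -1] (fun h => by simpa using congrFun h 0)
      refine hv ?_
      have h1 := H _ (hPF v)
      have h2 : P v - F (P v) = 0 := by
        rw [h4] at h1
        exact pow_eq_zero_iff two_ne_zero |>.1 (by linear_combination h1)
      rw [hP] at h2
      simp only [map_add, map_sub, map_mul, hFτ] at h2
      simp only [Matrix.cons_val]
      linear_combination h2
    · obtain ⟨v, hv⟩ := hex ![-1, -τ, τ, 1, 0] (fun h => by simpa using congrFun h 0)
      refine hv ?_
      have h0 : P v = 0 := by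
        obtain ⟨h1, h2⟩ := hc v
        have h3 : (τ - 2) * ((τ + 2) * P v) = 0 := by linear_combination -2 * h1 - τ * h2
        have h5 := (mul_eq_zero.1 h3).resolve_left (sub_ne_zero.2 h4)
        rcases mul_eq_zero.1 h5 with h6 | h6
        · exact absurd (show (1 : L) = 0 by grind) one_ne_zero
        · exact h6
      rw [hP] at h0
      simp only [Matrix.cons_val]
      linear_combination h0
  refine exists_quintic_normal_form_of_conjugates hn (fun i : Fin 5 => F ^ (i : ℕ)) hF
    (x := y) ?_ ?_ ?_ ?_
  · rintro ⟨k, rfl⟩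
    rw [F.commutes, F.commutes] at hy
    rw [F.commutes] at hQ
    exact hQ (by linear_combination algebraMap K L k * hy)
  all_goals
    have hval : (fun i : Fin 5 => (F ^ (i : ℕ)) y) = ![y, F y, τ * F y - y,
        τ * (τ * F y - y) - F y, τ * (τ * (τ * F y - y) - F y) - (τ * F y - y)] := by
      funext i
      fin_cases i <;> simp [AlgHom.coe_pow, hy, hFτ]
    rw [hval]
  · simp only [quint1, Matrix.cons_val]
    grind
  · simp only [quint3, Matrix.cons_val]
    grind
  · have : quint4 ![y, F y, τ * F y - y,
        τ * (τ * F y - y) - F y, τ * (τ * (τ * F y - y) - F y) - (τ * F y - y)] =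
        (τ * (y ^ 2 + F y ^ 2 - τ * y * F y)) ^ 2 := by
      simp only [quint4, Matrix.cons_val]
      grind
    rw [this]
    exact pow_ne_zero 2 (mul_ne_zero hτ0 hQ)

end CyclicQuintic

/-! ### Parametrisation over the quadratic extension when τ is not in K -/

section QuinticTorus

variable {M : Type*} [Field M] (F : M →+* M) (τ : M)

def quinticAlpha (y : M) : M :=
  (1 + 2 * τ) * F (F y) ^ 2 * F (F (F y)) + (2 - τ) * F (F y) ^ 2 * F y +
    (4 - 2 * τ) * y * F (F y) * F y - (1 + 2 * τ) * y ^ 2 * F (F (F y)) - (1 + 2 * τ) * y ^ 2 * F y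

variable {F τ}

theorem map_map_quinticAlpha (hτ : τ ^ 2 + τ = 1) (hF : F τ = -1 - τ) {y : M}
    (hy : F (F (F (F y))) = τ * F (F y) - y) :
    F (F (quinticAlpha F τ y)) = quinticAlpha F τ y := by
  simp only [quinticAlpha, map_add, map_sub, map_mul, map_pow, hy, hF, map_neg, map_one, map_ofNat]
  grind

theorem quinticAlpha_mul {u y : M} (hu : F (F u) = u) :
    quinticAlpha F τ (u * y) = u ^ 2 * F u * quinticAlpha F τ y := by
  simp only [quinticAlpha, map_mul, hu]
  ring

/-- F² fixes τ and satisfies T² - τT + 1 = 0 at y, so F¹⁰ y = y and y + F⁵ y is fixed by F⁵. The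
condition e₃ = 0 becomes a trace condition on α = `quinticAlpha F τ y`, which F² fixes. -/
theorem quintic_torus (hτ : τ ^ 2 + τ = 1) (hF : F τ = -1 - τ) {x y : M}
    (hy : F (F (F (F y))) = τ * F (F y) - y) (hx : x = y + F (F (F (F (F y))))) :
    F (F (F (F (F x)))) = x ∧ quint1 ![x, F x, F (F x), F (F (F x)), F (F (F (F x)))] = 0 ∧
    quint3 ![x, F x, F (F x), F (F (F x)), F (F (F (F x)))] =
      quinticAlpha F τ y + F (quinticAlpha F τ y) := by
  subst hx
  simp only [quinticAlpha, map_add, map_sub, map_mul, map_pow, hy, hF, map_neg, map_one, map_ofNat,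
    quint1, quint3, Matrix.cons_val]
  refine ⟨?_, ?_, ?_⟩
  · grind
  · grind
  · grind

/-- Applying F⁵ to `hy` replaces τ by its conjugate; subtracting leaves (1 + 2τ)F² y = 0. -/
theorem eq_zero_of_add_eq_zero (hF : F τ = -1 - τ) (h5 : 1 + 2 * τ ≠ 0) {y : M}
    (hy : F (F (F (F y))) = τ * F (F y) - y) (hx : y + F (F (F (F (F y)))) = 0) : y = 0 := by
  have h1 : F (F (F (F (F y)))) = -y := by linear_combination hx
  have h2 := congrArg (fun z => F (F (F (F (F z))))) hy
  simp only [map_sub, map_mul, h1, hF, map_neg, map_one] at h2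
  have h3 : (1 + 2 * τ) * F (F y) = 0 := by linear_combination -h2 - hy
  simpa using (mul_eq_zero.1 h3).resolve_left h5

end QuinticTorus

/-! ### Counting solutions with e₁ = e₃ = 0 -/

section FiniteQuintic

theorem mem_range_of_pow_card_eq {M E : Type*} [Field M] [Fintype M] [Field E] (f : M →+* E)
    {x : E} (hx : x ^ Fintype.card M = x) : ∃ z, f z = x := by
  classical
  have hne := FiniteField.X_pow_card_sub_X_ne_zero E (Fintype.one_lt_card (α := M))
  have hsub : Finset.univ.image f ⊆ (X ^ Fintype.card M - X : E[X]).roots.toFinset := by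
    intro y hy
    obtain ⟨z, -, rfl⟩ := Finset.mem_image.1 hy
    rw [Multiset.mem_toFinset, mem_roots hne]
    simp [← map_pow, FiniteField.pow_card]
  have heq := Finset.eq_of_subset_of_card_le hsub (by
    rw [Finset.card_image_of_injective _ f.injective, Finset.card_univ]
    refine (Multiset.toFinset_card_le _).trans ((card_roots' _).trans ?_)
    rw [FiniteField.X_pow_card_sub_X_natDegree_eq E Fintype.one_lt_card])
  have : x ∈ (X ^ Fintype.card M - X : E[X]).roots.toFinset := by
    rw [Multiset.mem_toFinset, mem_roots hne]
    simp [hx]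
  rw [← heq] at this
  simpa using this

variable {E : Type*} [Field E] [IsAlgClosed E] {F : E →+* E} {q : ℕ}

theorem exists_finset_card_eq_of_separable {P : E[X]} (hP : P.Separable) :
    ∃ V : Finset E, V.card = P.natDegree ∧ ∀ y, y ∈ V ↔ P.eval y = 0 := by
  classical
  refine ⟨P.roots.toFinset, ?_, fun y => ?_⟩
  · rw [Multiset.toFinset_card_of_nodup (nodup_roots hP),
      ← (IsAlgClosed.splits P).natDegree_eq_card_roots]
  · rw [Multiset.mem_toFinset, mem_roots hP.ne_zero, IsRoot.def]

/-- The polynomial X^(q⁴) - τX^(q²) + X has derivative 1, so its roots are distinct. -/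
theorem exists_finset_card_eq_pow_four (hF : ∀ y, F y = y ^ q) (hq : 1 < q) (hq0 : (q : E) = 0)
    (τ : E) : ∃ V : Finset E, V.card = q ^ 4 ∧
      ∀ y, y ∈ V ↔ F (F (F (F y))) = τ * F (F y) - y := by
  have hlt : q ^ 2 < q ^ 4 := Nat.pow_lt_pow_right hq (by norm_num)
  have h1 : 1 < q ^ 4 := Nat.one_lt_pow (by norm_num) hq
  obtain ⟨V, hV, h⟩ := exists_finset_card_eq_of_separable
    (P := X ^ q ^ 4 + (X - C τ * X ^ q ^ 2)) (by
      have : derivative (X ^ q ^ 4 + (X - C τ * X ^ q ^ 2)) = 1 := by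
        simp [derivative_X_pow, hq0]
      rw [Separable, this]
      exact isCoprime_one_right)
  refine ⟨V, ?_, fun y => ?_⟩
  · rw [hV, natDegree_add_eq_left_of_natDegree_lt, natDegree_X_pow]
    rw [natDegree_X_pow]
    refine (natDegree_sub_le _ _).trans_lt (max_lt (natDegree_X.trans_lt h1) ?_)
    exact (natDegree_C_mul_X_pow_le _ _).trans_lt hlt
  · rw [h]
    simp only [hF, ← pow_mul, eval_add, eval_sub, eval_mul, eval_pow, eval_X, eval_C]
    rw [show q * q * q * q = q ^ 4 by ring, show q * q = q ^ 2 by ring]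
    grind

/-- A double count over the group of u ≠ 0 with F² u = u, of order q² - 1, acting on the q⁴ - 1
nonzero solutions: for each y, at least q - 1 of the multiples uy satisfy the trace condition. -/
theorem exists_finset_quintic_torus (hF : ∀ y, F y = y ^ q) (hq : 1 < q) (hq0 : (q : E) = 0)
    {τ : E} (hτ : τ ^ 2 + τ = 1) (hFτ : F τ = -1 - τ) :
    ∃ S : Finset E, (q ^ 2 + 1) * (q - 1) ≤ S.card ∧ ∀ y ∈ S, y ≠ 0 ∧
      F (F (F (F y))) = τ * F (F y) - y ∧ quinticAlpha F τ y + F (quinticAlpha F τ y) = 0 := by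
  classical
  obtain ⟨V, hVc, hV⟩ := exists_finset_card_eq_pow_four hF hq hq0 τ
  have hFF : ∀ u, F (F u) = u ^ q ^ 2 := fun u => by rw [hF, hF, ← pow_mul, pow_two]
  have hq2 : 1 < q ^ 2 := Nat.one_lt_pow (by norm_num) hq
  set S := V.filter fun y => y ≠ 0 ∧ quinticAlpha F τ y + F (quinticAlpha F τ y) = 0 with hS
  refine ⟨S, ?_, fun y hy => ?_⟩
  swap
  · rw [hS, Finset.mem_filter, hV] at hy
    exact ⟨hy.2.1, hy.1, hy.2.2⟩
  let U : Finset E := nthRootsFinset (q ^ 2 - 1) (1 : E)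
  have hU : ∀ u, u ∈ U ↔ u ≠ 0 ∧ F (F u) = u := fun u => by
    rw [mem_nthRootsFinset (by omega), hFF]
    constructor
    · intro h
      refine ⟨?_, ?_⟩
      · rintro rfl
        rw [zero_pow (by omega)] at h
        exact zero_ne_one h
      · rw [← Nat.sub_add_cancel hq2.le, pow_succ, h, one_mul]
    · rintro ⟨h0, h⟩
      rw [← Nat.sub_add_cancel hq2.le, pow_succ] at h
      exact mul_right_cancel₀ h0 (by rw [h, one_mul])
  have hUc : U.card ≤ q ^ 2 - 1 :=
    (Multiset.toFinset_card_le _).trans (card_nthRoots _ _)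
  have hmul := Finset.card_mul_le_card_mul (s := V.erase 0) (t := S)
    (fun y s => ∃ u ∈ U, s = u * y) (m := q - 1) (n := q ^ 2 - 1) ?_ ?_
  · rw [Finset.card_erase_of_mem ((hV 0).2 (by simp)), hVc] at hmul
    obtain ⟨k, rfl⟩ : ∃ k, q = k + 2 := ⟨q - 2, by omega⟩
    have e1 : (k + 2) ^ 4 - 1 = ((k + 2) ^ 2 + 1) * ((k + 2) ^ 2 - 1) := by
      have : 1 ≤ (k + 2) ^ 2 := hq2.le
      zify [this, show 1 ≤ (k + 2) ^ 4 from Nat.one_le_pow _ _ (by omega)]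
      ring
    rw [e1, mul_right_comm] at hmul
    exact Nat.le_of_mul_le_mul_right hmul (by omega)
  · intro y hy
    rw [Finset.mem_erase, hV] at hy
    obtain ⟨hy0, hy⟩ := hy
    have hαα := map_map_quinticAlpha hτ hFτ hy
    -- For F u = cu the trace condition on uy reduces to α + c F α = 0, and c F c = 1 ensures F² u =
    -- u. There are q - 1 such u, the roots of X^(q-1) = c.
    obtain ⟨c, hc0, hcF, hc⟩ : ∃ c : E, c ≠ 0 ∧ c * F c = 1 ∧
        quinticAlpha F τ y + c * F (quinticAlpha F τ y) = 0 := by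
      by_cases h0 : quinticAlpha F τ y = 0
      · exact ⟨1, one_ne_zero, by simp, by simp [h0]⟩
      · have h1 : F (quinticAlpha F τ y) ≠ 0 := by simpa using h0
        refine ⟨-quinticAlpha F τ y / F (quinticAlpha F τ y), ?_, ?_, ?_⟩
        · exact div_ne_zero (neg_ne_zero.2 h0) h1
        · rw [map_div₀, map_neg, hαα]
          field_simp
        · field_simp
          ring
    obtain ⟨R, hRc, hR⟩ := exists_finset_card_eq_of_separable (separable_X_pow_sub_C (n := q - 1) c
      (by rw [Nat.cast_sub hq.le, hq0]; simp) hc0)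
    rw [natDegree_X_pow_sub_C] at hRc
    rw [← hRc, ← Finset.card_image_of_injective R (mul_left_injective₀ hy0)]
    refine Finset.card_le_card fun s hs => ?_
    obtain ⟨u, hu, rfl⟩ := Finset.mem_image.1 hs
    simp only [hR, eval_sub, eval_pow, eval_X, eval_C, sub_eq_zero] at hu
    have hu0 : u ≠ 0 := by
      rintro rfl
      rw [zero_pow (by omega)] at hu
      exact hc0 hu.symm
    have hFu : F u = c * u := by
      rw [hF, ← hu, ← pow_succ, Nat.sub_add_cancel hq.le]
    have hFFu : F (F u) = u := by
      rw [hFu, map_mul, hFu]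
      linear_combination u * hcF
    rw [Finset.mem_bipartiteAbove]
    refine ⟨?_, u, (hU u).2 ⟨hu0, hFFu⟩, rfl⟩
    rw [hS, Finset.mem_filter, hV]
    refine ⟨?_, mul_ne_zero hu0 hy0, ?_⟩
    · simp only [map_mul, hFFu, hy]
      ring
    · rw [quinticAlpha_mul hFFu]
      simp only [map_mul, map_pow, hFu]
      linear_combination u ^ 3 * c * hc + u ^ 3 * c ^ 2 * F (quinticAlpha F τ y) * hcF
  · intro s _
    refine le_trans ?_ hUc
    refine (Finset.card_le_card (t := U.image fun u => u⁻¹ * s) fun y hy => ?_).trans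
      Finset.card_image_le
    rw [Finset.mem_bipartiteBelow] at hy
    obtain ⟨-, u, hu, rfl⟩ := hy
    exact Finset.mem_image.2 ⟨u, hu, inv_mul_cancel_left₀ ((hU u).1 hu).1 y⟩

end FiniteQuintic

/-! ### Quintics over finite fields -/

section FiniteQuintic

variable {K L E : Type*} [Field K] [Field L] [Algebra K L] [FiniteDimensional K L]
  [Field E] [Algebra K E]

/-- A nontrivial fifth root of unity r would give t = r + r⁴. -/
theorem pow_five_injective (h : ¬ ∃ t : K, t ^ 2 + t = 1) : Function.Injective fun k : K => k ^ 5 := by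
  intro a b hab
  simp only at hab
  by_cases hb : b = 0
  · subst hb
    simpa using hab
  by_contra hne
  have h1 : (a / b) ^ 5 = 1 := by rw [div_pow, hab, div_self (pow_ne_zero 5 hb)]
  have h2 : a / b - 1 ≠ 0 := by rwa [sub_ne_zero, Ne, div_eq_one_iff_eq hb]
  generalize a / b = r at h1 h2
  have h3 : r ^ 4 + r ^ 3 + r ^ 2 + r + 1 = 0 :=
    (mul_eq_zero.1 (show (r - 1) * (r ^ 4 + r ^ 3 + r ^ 2 + r + 1) = 0 by
      linear_combination h1)).resolve_left h2
  exact h ⟨r + r ^ 4, by linear_combination h3 + (2 + r ^ 3) * h1⟩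

theorem minpoly_eq_of_quint_eq_zero (hn : Module.finrank K L = 5) (σ : Fin 5 → L →ₐ[K] E)
    (hσ : Function.Injective σ) {x : L} (hx : x ∉ (algebraMap K L).range)
    (h1 : quint1 (fun i => σ i x) = 0) (h3 : quint3 (fun i => σ i x) = 0)
    (h4 : quint4 (fun i => σ i x) = 0) :
    ∃ b e : K, minpoly K x = X ^ 5 + C b * X ^ 3 + C e := by
  have hgen := adjoin_eq_top_of_finrank_prime (by rw [hn]; norm_num) hx
  have h := (minpoly_map_eq_prod hn σ (injective_apply_of_adjoin_eq_top hσ hgen)).2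
  rw [prod_X_sub_C_fin_five, h1, h3, h4] at h
  have hb : quint2 (fun i => σ i x) = algebraMap K E ((minpoly K x).coeff 3) := by
    rw [← coeff_map, h]
    simp
  have he : -quint5 (fun i => σ i x) = algebraMap K E ((minpoly K x).coeff 0) := by
    rw [← coeff_map, h]
    simp
  refine ⟨(minpoly K x).coeff 3, (minpoly K x).coeff 0, ?_⟩
  apply map_injective _ (algebraMap K E).injective
  rw [h, hb]
  simp only [Polynomial.map_add, Polynomial.map_mul, Polynomial.map_pow, map_X, map_C, ← he,
    map_zero, map_neg]
  ring

theorem card_filter_quintic_le [DecidableEq E] (S : Finset E) (f : E → E) (hf : Set.InjOn f S)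
    (b e : E) : (S.filter fun y => f y ^ 5 + b * f y ^ 3 + e = 0).card ≤ 5 := by
  have hdeg : (X ^ 5 + C b * X ^ 3 + C e : E[X]).natDegree = 5 := by compute_degree!
  have hne : (X ^ 5 + C b * X ^ 3 + C e : E[X]) ≠ 0 := by
    intro h
    rw [h] at hdeg
    simp at hdeg
  refine le_trans ?_ (((Multiset.toFinset_card_le _).trans (card_roots' _)).trans hdeg.le)
  refine Finset.card_le_card_of_injOn f (fun y hy => ?_) (hf.mono (Finset.filter_subset _ _))
  have := (Finset.mem_filter.1 hy).2
  simpa [mem_roots hne] using this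

theorem exists_quintic_normal_form_of_finite [Finite K] (hn : Module.finrank K L = 5)
    (hK : Nat.card K ≠ 2) :
    ∃ (x : L) (b c : K), K⟮x⟯ = ⊤ ∧ minpoly K x = X ^ 5 + C b * X ^ 3 + C c * X + C c := by
  classical
  have := Fintype.ofFinite K
  have hLf : Finite L := Module.finite_of_finite K
  have := Fintype.ofFinite L
  have hfrob := (FiniteField.bijective_frobeniusAlgHom_pow K L).injective
  rw [hn] at hfrob
  by_cases h : ∃ t : K, t ^ 2 + t = 1
  · obtain ⟨t, ht⟩ := h
    refine exists_quintic_normal_form_of_cyclic hn (FiniteField.frobeniusAlgHom K L) hfrob ?_ ht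
    rw [← hn, ← FiniteField.orderOf_frobeniusAlgHom K L, pow_orderOf_eq_one]
  have hK5 : (5 : K) ≠ 0 := fun h5 => h ⟨2, by linear_combination h5⟩
  have hpow5 := Finite.injective_iff_surjective.1 (pow_five_injective h)
  let E := AlgebraicClosure K
  let ι : L →ₐ[K] E := IsAlgClosed.lift
  have hE5 : (5 : E) ≠ 0 := by rwa [← map_ofNat (algebraMap K E) 5, Ne, map_eq_zero]
  let F : E →+* E := (FiniteField.frobeniusAlgHom K E).toRingHom
  have hF : ∀ y, F y = y ^ Fintype.card K := fun y => rfl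
  have hq := Fintype.one_lt_card (α := K)
  have hq0 : (Fintype.card K : E) = 0 := by
    rw [← map_natCast (algebraMap K E), FiniteField.cast_card_eq_zero, map_zero]
  obtain ⟨τ, hτ⟩ : ∃ τ : E, τ ^ 2 + τ = 1 := by
    obtain ⟨τ, hτ⟩ := IsAlgClosed.exists_root (X ^ 2 + X - 1 : E[X]) (by
      rw [show (X ^ 2 + X - 1 : E[X]).degree = 2 by compute_degree!]; decide)
    exact ⟨τ, by simpa [sub_eq_zero] using hτ⟩
  have hFτ : F τ = -1 - τ := by
    have h1 := congrArg F hτ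
    rw [map_add, map_pow, map_one] at h1
    rcases mul_eq_zero.1 (show (F τ - τ) * (F τ - (-1 - τ)) = 0 by linear_combination h1 - hτ)
      with h2 | h2
    · obtain ⟨t, rfl⟩ := mem_range_of_pow_card_eq (algebraMap K E) (sub_eq_zero.1 h2)
      exact absurd ⟨t, (algebraMap K E).injective (by simpa using hτ)⟩ h
    · exact sub_eq_zero.1 h2
  have h12 : 1 + 2 * τ ≠ 0 := fun h0 => hE5 (by linear_combination (1 + 2 * τ) * h0 - 4 * hτ)
  obtain ⟨S, hSc, hS⟩ := exists_finset_quintic_torus hF hq hq0 hτ hFτ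
  let f : E → E := fun y => y + F (F (F (F (F y))))
  have hf0 : ∀ y, F (F (F (F y))) = τ * F (F y) - y → f y = 0 → y = 0 := fun y hy h0 =>
    eq_zero_of_add_eq_zero hFτ h12 hy h0
  have hinj : Set.InjOn f S := fun y hy y' hy' hyy => by
    rw [← sub_eq_zero]
    refine hf0 _ ?_ ?_
    · simp only [map_sub, (hS y hy).2.1, (hS y' hy').2.1]; ring
    · simp only [f, map_sub] at hyy ⊢
      linear_combination hyy
  let σ : Fin 5 → L →ₐ[K] E := fun i => ι.comp (FiniteField.frobeniusAlgHom K L ^ (i : ℕ))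
  have hσ : Function.Injective σ := fun i j hij => hfrob (by
    ext z
    exact ι.injective (DFunLike.congr_fun hij z))
  have hσv : ∀ z, (fun i => σ i z) =
      ![ι z, F (ι z), F (F (ι z)), F (F (F (ι z))), F (F (F (F (ι z))))] := by
    intro z
    funext i
    fin_cases i <;> simp [σ, AlgHom.coe_pow, hF]
  by_contra hno
  have hmin : ∀ y ∈ S, ∃ b e : K, f y ^ 5 + algebraMap K E b * f y ^ 3 + algebraMap K E e = 0 ∧
      ∀ k : K, k ^ 5 + b * k ^ 3 + e ≠ 0 := by
    intro y hy
    obtain ⟨hy0, hyV, hα⟩ := hS y hy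
    obtain ⟨hx5, h1, h3⟩ := quintic_torus hτ hFτ hyV rfl
    rw [hα] at h3
    obtain ⟨z, hz⟩ := mem_range_of_pow_card_eq (ι : L →+* E) (x := f y) (by
      rw [Module.card_eq_pow_finrank (K := K) (V := L), hn]
      have hx : F (F (F (F (F (f y))))) = f y := hx5
      generalize f y = x at hx
      simp only [hF, ← pow_mul] at hx
      convert hx using 2
      ring)
    have hz : ι z = f y := hz
    have hzr : z ∉ (algebraMap K L).range := by
      rintro ⟨k, rfl⟩
      rw [AlgHom.commutes] at hz
      have hk : F (algebraMap K E k) = algebraMap K E k :=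
        (FiniteField.frobeniusAlgHom K E).commutes k
      change quint1 ![f y, F (f y), F (F (f y)), F (F (F (f y))), F (F (F (F (f y))))] = 0 at h1
      rw [← hz, hk, hk, hk, hk] at h1
      simp only [quint1, Matrix.cons_val] at h1
      refine hy0 (hf0 y hyV (hz.symm.trans ?_))
      exact (mul_eq_zero.1 (show (5 : E) * algebraMap K E k = 0 by
        linear_combination h1)).resolve_left hE5
    have h1' : quint1 (fun i => σ i z) = 0 := by rw [hσv, hz]; exact h1
    have h3' : quint3 (fun i => σ i z) = 0 := by rw [hσv, hz]; exact h3
    obtain ⟨b, e, hbe⟩ := minpoly_eq_of_quint_eq_zero hn σ hσ hzr h1' h3' (by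
      by_contra h4
      exact hno (exists_quintic_normal_form_of_conjugates hn σ hσ hzr h1' h3' h4))
    refine ⟨b, e, ?_, fun k hk => hzr ⟨k, ?_⟩⟩
    · have := congrArg ι (minpoly.aeval K z)
      rw [hbe] at this
      simpa [hz] using this
    · refine minpoly.root (Algebra.IsIntegral.isIntegral z) ?_
      rw [hbe]
      simpa [IsRoot.def] using hk
  -- X⁵ + b₀X³ - 1 - b₀ has the root 1. Discarding this one pair matters only for q = 3, where
  -- otherwise both sides of the count are 20.
  obtain ⟨b₀, hb₀⟩ : ∃ b₀ : K, b₀ ∉ ({0, -1} : Finset K) := by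
    by_contra! hall
    have h1 := Finset.card_le_card (fun k _ => hall k : (Finset.univ : Finset K) ⊆ {0, -1})
    have h2 := Finset.card_le_two (a := (0 : K)) (b := -1)
    rw [Finset.card_univ] at h1
    rw [Nat.card_eq_fintype_card] at hK
    omega
  simp only [Finset.mem_insert, Finset.mem_singleton, not_or] at hb₀
  let T : Finset (K × K) :=
    ((Finset.univ.erase 0) ×ˢ (Finset.univ.erase 0)).erase (b₀, -1 - b₀)
  have hsub : S ⊆ T.biUnion fun p => S.filter fun y =>
      f y ^ 5 + algebraMap K E p.1 * f y ^ 3 + algebraMap K E p.2 = 0 := by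
    intro y hy
    obtain ⟨b, e, hbe, hk⟩ := hmin y hy
    refine Finset.mem_biUnion.2 ⟨(b, e), ?_, Finset.mem_filter.2 ⟨hy, hbe⟩⟩
    simp only [T, Finset.mem_erase, Finset.mem_product, Finset.mem_univ, and_true, Ne,
      Prod.mk.injEq]
    refine ⟨?_, ?_, ?_⟩
    · rintro ⟨rfl, rfl⟩
      exact hk 1 (by ring)
    · rintro rfl
      obtain ⟨k, hk'⟩ := hpow5 (-e)
      exact hk k (by simp only at hk'; rw [hk']; ring)
    · rintro rfl
      exact hk 0 (by simp)
  have hcard := (hSc.trans (Finset.card_le_card hsub)).trans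
    (Finset.card_biUnion_le_card_mul _ _ 5 fun p _ =>
      card_filter_quintic_le S f hinj (algebraMap K E p.1) (algebraMap K E p.2))
  have hT : T.card = (Fintype.card K - 1) * (Fintype.card K - 1) - 1 := by
    rw [Finset.card_erase_of_mem, Finset.card_product, Finset.card_erase_of_mem (Finset.mem_univ _),
      Finset.card_univ]
    simp only [Finset.mem_product, Finset.mem_erase, Finset.mem_univ, and_true]
    exact ⟨hb₀.1, fun h0 => hb₀.2 (by linear_combination -h0)⟩
  rw [hT] at hcard
  rw [Nat.card_eq_fintype_card] at hK
  -- With q = k + 3 the count would give k³ + 8k² + 22k + 20 ≤ 5(k² + 4k + 3).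
  obtain ⟨k, hk⟩ : ∃ k, Fintype.card K = k + 3 := ⟨Fintype.card K - 3, by omega⟩
  rw [hk, show k + 3 - 1 = k + 2 by omega,
    show (k + 2) * (k + 2) - 1 = k ^ 2 + 4 * k + 3 from by
      rw [show (k + 2) * (k + 2) = k ^ 2 + 4 * k + 3 + 1 by ring, Nat.add_sub_cancel]] at hcard
  nlinarith [Nat.zero_le (k ^ 3)]

end FiniteQuintic

/-! ### The exceptional field with two elements -/

section FieldTwo

variable {K L : Type*} [Field K] [Field L] [Algebra K L] [FiniteDimensional K L]

theorem exists_minpoly_eq_of_card_two (hn : Module.finrank K L = 5) (hK : Nat.card K = 2)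
    (h2 : (2 : K) = 0) (h01 : ∀ k : K, k = 0 ∨ k = 1) :
    ∃ x : L, K⟮x⟯ = ⊤ ∧ minpoly K x = X ^ 5 + X ^ 3 + 1 := by
  have : Finite K := Nat.finite_of_card_ne_zero (by rw [hK]; norm_num)
  have : Finite L := Module.finite_of_finite K
  have := Fintype.ofFinite K
  have := Fintype.ofFinite L
  let ι : L →ₐ[K] AlgebraicClosure K := IsAlgClosed.lift
  have h2' : (2 : AlgebraicClosure K) = 0 := by
    rw [← map_ofNat (algebraMap K (AlgebraicClosure K)) 2, h2, map_zero]
  have hdeg : (X ^ 5 + X ^ 3 + 1 : K[X]).natDegree = 5 := by compute_degree!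
  obtain ⟨w, hw⟩ := IsAlgClosed.exists_root (X ^ 5 + X ^ 3 + 1 : (AlgebraicClosure K)[X]) (by
    rw [show (X ^ 5 + X ^ 3 + 1 : (AlgebraicClosure K)[X]).degree = 5 by compute_degree!]; decide)
  replace hw : w ^ 5 + w ^ 3 + 1 = 0 := by simpa using hw
  -- L has 32 elements, so a root w comes from L once w³² = w, which repeated squaring shows.
  obtain ⟨x, hx⟩ := mem_range_of_pow_card_eq (ι : L →+* AlgebraicClosure K) (x := w) (by
    rw [Module.card_eq_pow_finrank (K := K) (V := L), hn, ← Nat.card_eq_fintype_card, hK]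
    have h8 : w ^ 8 = w ^ 4 + w ^ 3 + w := by grind
    have h16 : w ^ 16 = w ^ 3 + w ^ 2 := by grind
    grind)
  have hx : ι x = w := hx
  have hx0 : x ^ 5 + x ^ 3 + 1 = 0 := ι.injective (by simpa [hx] using hw)
  have hgen : K⟮x⟯ = ⊤ := by
    refine adjoin_eq_top_of_finrank_prime (by rw [hn]; norm_num) ?_
    rintro ⟨k, rfl⟩
    rw [← map_pow, ← map_pow, ← map_one (algebraMap K L), ← map_add, ← map_add, map_eq_zero] at hx0
    rcases h01 k with rfl | rfl
    · simp at hx0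
    · exact one_ne_zero (by linear_combination hx0 - h2 : (1 : K) = 0)
  refine ⟨x, hgen, minpoly_eq_of_adjoin_eq_top hgen ?_ (by rw [hdeg, hn]) (by simpa using hx0)⟩
  monicity!

/-- All candidates are reducible: c = 0 gives the factor X, and X⁵ + X + 1 = (X² + X + 1)(X³ + X² +
1), X⁵ + X³ + X + 1 = (X + 1)(X⁴ + X³ + 1). -/
theorem not_exists_minpoly_eq_of_two_eq_zero (hn : Module.finrank K L = 5)
    (h2 : (2 : K) = 0) (h01 : ∀ k : K, k = 0 ∨ k = 1) :
    ¬ ∃ (x : L) (b c : K), K⟮x⟯ = ⊤ ∧ minpoly K x = X ^ 5 + C b * X ^ 3 + C c * X + C c := by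
  rintro ⟨x, b, c, hx, hmin⟩
  have h2' : (2 : L) = 0 := by rw [← map_ofNat (algebraMap K L) 2, h2, map_zero]
  have key : ∀ P Q : K[X], P.natDegree < 5 → Q.natDegree < 5 → P ≠ 0 → Q ≠ 0 →
      aeval x P * aeval x Q ≠ 0 := fun P Q hP hQ hP0 hQ0 =>
    mul_ne_zero (aeval_ne_zero_of_natDegree_lt hx hP0 (by rwa [hn]))
      (aeval_ne_zero_of_natDegree_lt hx hQ0 (by rwa [hn]))
  have h := minpoly.aeval K x
  rw [hmin] at h
  simp only [map_add, map_mul, map_pow, aeval_X, aeval_C] at h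
  have hmon : ∀ {P : K[X]} {n : ℕ}, P.natDegree = n → n < 5 → 0 < n → P.natDegree < 5 ∧ P ≠ 0 :=
    fun h1 h2 h3 => ⟨h1 ▸ h2, fun h0 => by simp [h0] at h1; omega⟩
  have key' : ∀ (P Q : K[X]) (m n : ℕ), P.natDegree = m → Q.natDegree = n → 0 < m → m < 5 →
      0 < n → n < 5 → aeval x P * aeval x Q ≠ 0 := fun P Q m n hP hQ hm hm' hn hn' =>
    key P Q (hmon hP hm' hm).1 (hmon hQ hn' hn).1 (hmon hP hm' hm).2 (hmon hQ hn' hn).2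
  rcases h01 c with rfl | rfl
  · refine key' X (X ^ 4 + C b * X ^ 2) 1 4 natDegree_X (by compute_degree!) (by norm_num)
      (by norm_num) (by norm_num) (by norm_num) ?_
    simp only [map_add, map_mul, map_pow, aeval_X, aeval_C, map_zero] at h ⊢
    linear_combination h
  rcases h01 b with rfl | rfl
  · refine key' (X ^ 2 + X + 1) (X ^ 3 + X ^ 2 + 1) 2 3 (by compute_degree!) (by compute_degree!)
      (by norm_num) (by norm_num) (by norm_num) (by norm_num) ?_
    simp only [map_add, map_pow, aeval_X, map_zero, map_one] at h ⊢
    linear_combination h + (x ^ 4 + x ^ 3 + x ^ 2) * h2'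
  · refine key' (X + 1) (X ^ 4 + X ^ 3 + 1) 1 4 (by compute_degree!) (by compute_degree!)
      (by norm_num) (by norm_num) (by norm_num) (by norm_num) ?_
    simp only [map_add, map_pow, aeval_X, map_one] at h ⊢
    linear_combination h + x ^ 4 * h2'

end FieldTwo

theorem nonempty_ringEquiv_zmod_two {K : Type*} [Field K] (hK : Nat.card K = 2) :
    Nonempty (K ≃+* ZMod 2) := by
  have : Finite K := Nat.finite_of_card_ne_zero (by rw [hK]; norm_num)
  have := Fintype.ofFinite K
  exact ⟨(ZMod.ringEquivOfPrime K Nat.prime_two (by rw [← hK, Nat.card_eq_fintype_card])).symm⟩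

theorem mainTheorem1 {K : Type*} {L : Type*} [Field K] [Field L] [Algebra K L]
    [Algebra.IsSeparable K L] :
    (Module.finrank K L = 5 →
      -- every field other than `𝔽₂`
      (¬ Nonempty (K ≃+* ZMod 2) →
        ∃ (x : L) (b c : K), K⟮x⟯ = ⊤ ∧
          minpoly K x = X ^ 5 + C b * X ^ 3 + C c * X + C c) ∧
      -- `𝔽₂` is a genuine exception, with its own normal form
      (Nonempty (K ≃+* ZMod 2) →
        (∃ x : L, K⟮x⟯ = ⊤ ∧ minpoly K x = X ^ 5 + X ^ 3 + 1) ∧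
        ¬ ∃ (x : L) (b c : K), K⟮x⟯ = ⊤ ∧
          minpoly K x = X ^ 5 + C b * X ^ 3 + C c * X + C c)) ∧
    (Module.finrank K L = 6 → ringChar K ≠ 2 →
      ∃ (x : L) (b c d : K), K⟮x⟯ = ⊤ ∧
        minpoly K x = X ^ 6 + C b * X ^ 4 + C c * X ^ 2 + C d * X + C d) := by
  refine ⟨fun hn => ?_, fun hn h2 => ?_⟩
  · have : FiniteDimensional K L := Module.finite_of_finrank_pos (by omega)
    refine ⟨fun hK => ?_, fun ⟨e⟩ => ?_⟩
    · rcases finite_or_infinite K with _ | _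
      · exact exists_quintic_normal_form_of_finite hn fun h => hK (nonempty_ringEquiv_zmod_two h)
      · exact exists_quintic_normal_form_of_infinite hn
    · have h2 : (2 : K) = 0 := e.injective (by rw [map_ofNat, map_zero]; rfl)
      have h01 : ∀ k : K, k = 0 ∨ k = 1 := fun k => by
        have h : ∀ z : ZMod 2, z = 0 ∨ z = 1 := by decide
        simpa using h (e k)
      exact ⟨exists_minpoly_eq_of_card_two hn (by rw [Nat.card_congr e.toEquiv, Nat.card_zmod]) h2
        h01, not_exists_minpoly_eq_of_two_eq_zero hn h2 h01⟩
  · have : FiniteDimensional K L := Module.finite_of_finrank_pos (by omega)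
    rcases finite_or_infinite K with _ | _
    · exact exists_sextic_normal_form_of_finite hn h2
    · exact exists_sextic_normal_form_of_infinite hn h2
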